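/- **Setting.** There are $n$ bidders. A click outcome profile $o\in\{0,1\}^n$ is drawn from a symmetric (permutation-invariant) distribution $\lambda$, otherwise arbitrarily correlated. Let $\lambda_k$ be the probability that $\|o\|_1=k$, and assume $\lambda_0>0$, $\lambda_1>0$ and $\lambda_k>0$ for some $k\ge 3$. A signaling $\pi$ assigns to each $o$ a probability distribution $\pi(\cdot\mid o)$ on signal profiles $x\in[0,1]^n$. It is calibrated if $\mathbb E[o_i\mid x_i]=x_i$ almost surely for every bidder $i$. Bidder $i$ bids $x_i$. Let $\mathrm{secmax}(x)$ be the second-highest entry of $x$. The revenue of $\pi$ is $\mathbb E_{o\sim\lambda,\,x\sim\pi(\cdot\mid o)}[\mathrm{secmax}(x)]$. A calibrated signaling is optimal if its revenue is at least that of every calibrated signaling. **Thresholds.** Put $A=\sum_{k=2}^n(k-2)\lambda_k$ and $$x^\star=\max\Big\{\frac{\lambda_1A+2\lambda_1\lambda_0(1-\sqrt2)}{\lambda_1+\sqrt2\,\lambda_0},\,0\Big\},\qquad t_1^\star=\frac{\lambda_1+x^\star}{2\lambda_1+x^\star},\qquad t_0^\star=\frac{A-x^\star}{2\lambda_0+(A-x^\star)}.$$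 Consider the linear system, in unknowns $(m_k,l_k)_{2\le k\le n}$: $l_n>0$; $m_k,l_k\ge0$ and $m_k+l_k=\frac{k-2}{k}$ for $2\le k\le n$; $\sum_{k=2}^n\lambda_kk\,m_k=x^\star$; $\sum_{k=2}^n\lambda_kk\,m_k+\sum_{k=2}^n\lambda_kk\,l_k=A$. **Theorem.** The linear system is solvable, and every solution satisfies $$t_1^\star=\frac{\lambda_1+\sum_{k=2}^n\lambda_kk\,m_k}{2\lambda_1+\sum_{k=2}^n\lambda_kk\,m_k},\qquad t_0^\star=\frac{\sum_{k=2}^n\lambda_kk\,l_k}{2\lambda_0+\sum_{k=2}^n\lambda_kk\,l_k}.$$ Moreover $t_1^\star\in[\tfrac12,1)$ and $t_0^\star\in(0,t_1^\star]$, and there is an optimal calibrated signaling $\pi^\star$ such that: (i) for every $o$, every bid profile in the support of $\pi^\star(\cdot\mid o)$ is multi-maximal, that is, at least two bidders share its highest bid; (ii) for every $o$, the distribution of $\mathrm{secmax}(x)$ under $x\sim\pi^\star(\cdot\mid o)$ is the point mass at $1$ if $\|o\|_1\ge2$, at $t_1^\star$ if $\|o\|_1=1$, and at $t_0^\star$ if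 $\|o\|_1=0$; (iii) $\pi^\star$ is efficiently computable. There is one algorithm, on a random access machine with logarithmic (bit) cost, that is given only $n$ and $\lambda_0,\dots,\lambda_n$ as fractions of integers, for any $n$ and $\lambda$ as above with all $\lambda_k$ rational. In time polynomial in $n+\sum_kc_k$, where $c_k$ is the larger bit length of the numerator and the denominator of $\lambda_k$, it outputs an exact finite description of $\pi^\star$: for each $k\in\{0,\dots,n\}$ a list of bid profiles with probability weights for the outcome profile $(1,\dots,1,0,\dots,0)$ with $k$ ones, all numbers being written as $(a+b\sqrt2)/d$ with integers $a,b,d$, $d>0$. For a general $o$ with $\|o\|_1=k$, $\pi^\star(\cdot\mid o)$ is the law of a profile drawn from the $k$-th list and then permuted by a uniformly random permutation of the bidders that carries $(1,\dots,1,0,\dots,0)$ to $o$. -/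

import Mathlib

open MeasureTheory Finset

noncomputable section

namespace CalibratedSignaling

/-! ### The auction: priors, signalings, calibration, revenue -/

/-- A click outcome profile of `n` bidders; `o i = true` means that bidder `i` gets a click. -/
abbrev Outcome (n : ℕ) : Type := Fin n → Bool

/-- The number of clicks of an outcome profile (its `ℓ₁`-norm). -/
def clicks {n : ℕ} (o : Outcome n) : ℕ := #{i | o i = true}

/-- A symmetric (exchangeable) prior on outcome profiles, arbitrarily correlated otherwise. -/
structure Prior (n : ℕ) where
  prob : Outcome n → ℝ
  nonneg : ∀ o, 0 ≤ prob o
  sum_one : ∑ o, prob o = 1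
  symm : ∀ (σ : Equiv.Perm (Fin n)) (o : Outcome n), prob (o ∘ σ) = prob o

/-- `lam.level k` is the prior probability of having exactly `k` clicks. -/
def Prior.level {n : ℕ} (lam : Prior n) (k : ℕ) : ℝ :=
  ∑ o with clicks o = k, lam.prob o

/-- A signaling structure with signals in `[0,1]`: for every outcome profile, a Borel probability
distribution of signal profiles, with arbitrary correlation between the bidders. Bids equal
signals. -/
structure Signaling (n : ℕ) where
  law : Outcome n → Measure (Fin n → ℝ)
  isProb : ∀ o, IsProbabilityMeasure (law o)
  mem_unit : ∀ o, ∀ᵐ x ∂(law o), ∀ i, x i ∈ Set.Icc (0 : ℝ) 1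

/-- The joint distribution of the outcome profile and the signal profile. -/
def joint {n : ℕ} (lam : Prior n) (π : Signaling n) : Measure (Outcome n × (Fin n → ℝ)) :=
  ∑ o, ENNReal.ofReal (lam.prob o) • (Measure.dirac o).prod (π.law o)

/-- Calibration: `E[o_i | x_i] = x_i` almost surely, for every bidder `i`. -/
def Calibrated {n : ℕ} (lam : Prior n) (π : Signaling n) : Prop :=
  ∀ i : Fin n,
    (joint lam π)[fun w => if w.1 i = true then (1 : ℝ) else 0 |
        MeasurableSpace.comap (fun w : Outcome n × (Fin n → ℝ) => w.2 i) inferInstance]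
      =ᵐ[joint lam π] fun w => w.2 i

/-- The second-highest entry of a bid profile (with multiplicity): the largest value of
`min (x i) (x j)` over pairs of different bidders. -/
def secmax {n : ℕ} (x : Fin n → ℝ) : ℝ :=
  ⨆ p : {p : Fin n × Fin n // p.1 ≠ p.2}, min (x p.1.1) (x p.1.2)

/-- At least two bidders share the highest bid. -/
def MultiMaximal {n : ℕ} (x : Fin n → ℝ) : Prop :=
  ∃ i j, i ≠ j ∧ x i = x j ∧ ∀ l, x l ≤ x i

/-- The expected second-highest bid. -/
def revenue {n : ℕ} (lam : Prior n) (π : Signaling n) : ℝ :=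
  ∑ o, lam.prob o * ∫ x, secmax x ∂(π.law o)

/-- `π` is calibrated and maximizes the revenue among all calibrated signalings. -/
def IsOptimal {n : ℕ} (lam : Prior n) (π : Signaling n) : Prop :=
  Calibrated lam π ∧ ∀ π' : Signaling n, Calibrated lam π' → revenue lam π' ≤ revenue lam π

/-! ### The thresholds, as functions of `n` and of the probabilities `L k` of `k` clicks -/

/-- `∑_{k=2}^n (k-2) L k`. -/
def excess (n : ℕ) (L : ℕ → ℝ) : ℝ := ∑ k ∈ Icc 2 n, ((k : ℝ) - 2) * L k

/-- The right-hand side of the linear system. -/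
def xStar (n : ℕ) (L : ℕ → ℝ) : ℝ :=
  max ((L 1 * excess n L + 2 * L 1 * L 0 * (1 - √2)) / (L 1 + √2 * L 0)) 0

/-- The linear system in the unknowns `m k`, `l k`, `2 ≤ k ≤ n`. -/
structure LinSys (n : ℕ) (L m l : ℕ → ℝ) : Prop where
  pos : 0 < l n
  nonneg : ∀ k ∈ Icc 2 n, 0 ≤ m k ∧ 0 ≤ l k
  add_eq : ∀ k ∈ Icc 2 n, m k + l k = ((k : ℝ) - 2) / k
  sum_m : ∑ k ∈ Icc 2 n, L k * (k * m k) = xStar n L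
  sum_all : ∑ k ∈ Icc 2 n, L k * (k * m k) + ∑ k ∈ Icc 2 n, L k * (k * l k) = excess n L

/-- The second-highest bid after exactly one click. -/
def tOne (n : ℕ) (L : ℕ → ℝ) : ℝ := (L 1 + xStar n L) / (2 * L 1 + xStar n L)

/-- The second-highest bid after no click. -/
def tZero (n : ℕ) (L : ℕ → ℝ) : ℝ :=
  (excess n L - xStar n L) / (2 * L 0 + (excess n L - xStar n L))

/-- The second-highest bid after `k` clicks. -/
def target (n : ℕ) (L : ℕ → ℝ) (k : ℕ) : ℝ :=
  if 2 ≤ k then 1 else if k = 1 then tOne n L else tZero n L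

/-! ### Explicit finite descriptions of signalings -/

/-- An exact number `(a + b √2) / d`. -/
structure Num where
  a : ℤ
  b : ℤ
  d : ℕ
  d_pos : 0 < d

def Num.val (x : Num) : ℝ := (x.a + x.b * √2) / x.d

def Num.encode (x : Num) : List ℤ := [x.a, x.b, x.d]

/-- A bid profile with a probability weight. -/
structure Atom (n : ℕ) where
  weight : Num
  bids : Fin n → Num

def Atom.encode {n : ℕ} (A : Atom n) : List ℤ :=
  A.weight.encode ++ (List.ofFn fun i => (A.bids i).encode).flatten

/-- For every `k ≤ n`, the finite list of weighted bid profiles for the outcome profile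
`(1,…,1,0,…,0)` with `k` ones. Other outcome profiles are treated by permuting the bidders. -/
abbrev Description (n : ℕ) : Type := Fin (n + 1) → List (Atom n)

/-- The numbers that make up a description, with the lengths of its lists. -/
def Description.encode {n : ℕ} (D : Description n) : List ℤ :=
  (List.ofFn fun k => ((D k).length : ℤ) :: (D k).flatMap Atom.encode).flatten

/-- The outcome profile in which exactly the first `k` bidders get a click. -/
def canonical (n k : ℕ) : Outcome n := fun i => decide (i.val < k)

/-- The permutations that carry `canonical n (clicks o)` to `o`. -/
def alignments {n : ℕ} (o : Outcome n) : Finset (Equiv.Perm (Fin n)) :=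
  {σ | canonical n (clicks o) ∘ σ = o}

theorem clicks_lt {n : ℕ} (o : Outcome n) : clicks o < n + 1 :=
  Nat.lt_succ_of_le ((Finset.card_le_univ _).trans_eq (Fintype.card_fin n))

/-- The bid distribution given `o`: draw a weighted bid profile from the list for `clicks o`, and
permute it by a uniformly random `σ` that carries `canonical n (clicks o)` to `o`. -/
def Description.law {n : ℕ} (D : Description n) (o : Outcome n) : Measure (Fin n → ℝ) :=
  ((D ⟨clicks o, clicks_lt o⟩).map fun A =>
    ENNReal.ofReal A.weight.val • ((#(alignments o) : ENNReal)⁻¹ •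
      ∑ σ ∈ alignments o, Measure.dirac ((fun i => (A.bids i).val) ∘ σ))).sum

/-- `D` describes `π`: its weights are nonnegative and it yields all conditional laws of `π`. -/
def Description.Describes {n : ℕ} (D : Description n) (π : Signaling n) : Prop :=
  (∀ k, ∀ A ∈ D k, 0 ≤ A.weight.val) ∧ ∀ o, π.law o = D.law o

/-! ### Algorithms: a random access machine with logarithmic (bit) cost

Registers and memory cells hold integers. The instructions are assignment of constants, integer
addition, subtraction and multiplication, indirect reading and writing, output of one integer,
and structured control flow. Every instruction is charged the bit lengths of the numbers it
touches, a multiplication the product of the bit lengths. -/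

inductive Prog : Type
  /-- `reg[dst] := c` -/
  | const (dst : ℕ) (c : ℤ)
  /-- `reg[dst] := reg[a] + reg[b]` -/
  | add (dst a b : ℕ)
  /-- `reg[dst] := reg[a] - reg[b]` -/
  | sub (dst a b : ℕ)
  /-- `reg[dst] := reg[a] * reg[b]` -/
  | mul (dst a b : ℕ)
  /-- `reg[dst] := mem[reg[addr]]` -/
  | load (dst addr : ℕ)
  /-- `mem[reg[addr]] := reg[src]` -/
  | store (addr src : ℕ)
  /-- append `reg[src]` to the output -/
  | print (src : ℕ)
  /-- `p`, then `q` -/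
  | seq (p q : Prog)
  /-- if `reg[r] > 0` then `p` else `q` -/
  | ite (r : ℕ) (p q : Prog)
  /-- while `reg[r] > 0` do `p` -/
  | loop (r : ℕ) (p : Prog)

/-- Registers, memory (cells are addressed by integers), and the output so far. -/
structure State where
  reg : ℕ → ℤ
  mem : ℤ → ℤ
  out : List ℤ

def State.setReg (s : State) (r : ℕ) (v : ℤ) : State :=
  { s with reg := Function.update s.reg r v }

def State.setMem (s : State) (a v : ℤ) : State :=
  { s with mem := Function.update s.mem a v }

/-- Number of bits of an integer, plus one for the sign. -/
def bits (z : ℤ) : ℕ := z.natAbs.size + 1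

/-- `Runs p s s' c`: from state `s`, program `p` halts in state `s'` at total cost `c`. -/
inductive Runs : Prog → State → State → ℕ → Prop
  | const (s : State) (dst : ℕ) (c : ℤ) :
      Runs (.const dst c) s (s.setReg dst c) (bits c)
  | add (s : State) (dst a b : ℕ) :
      Runs (.add dst a b) s (s.setReg dst (s.reg a + s.reg b)) (bits (s.reg a) + bits (s.reg b))
  | sub (s : State) (dst a b : ℕ) :
      Runs (.sub dst a b) s (s.setReg dst (s.reg a - s.reg b)) (bits (s.reg a) + bits (s.reg b))
  | mul (s : State) (dst a b : ℕ) :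
      Runs (.mul dst a b) s (s.setReg dst (s.reg a * s.reg b)) (bits (s.reg a) * bits (s.reg b))
  | load (s : State) (dst addr : ℕ) :
      Runs (.load dst addr) s (s.setReg dst (s.mem (s.reg addr)))
        (bits (s.reg addr) + bits (s.mem (s.reg addr)))
  | store (s : State) (addr src : ℕ) :
      Runs (.store addr src) s (s.setMem (s.reg addr) (s.reg src))
        (bits (s.reg addr) + bits (s.reg src))
  | print (s : State) (src : ℕ) :
      Runs (.print src) s { s with out := s.out ++ [s.reg src] } (bits (s.reg src))
  | seq {p q : Prog} {s s' s'' : State} {c c' : ℕ} :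
      Runs p s s' c → Runs q s' s'' c' → Runs (.seq p q) s s'' (c + c')
  | ite_pos {r : ℕ} {p q : Prog} {s s' : State} {c : ℕ} :
      0 < s.reg r → Runs p s s' c → Runs (.ite r p q) s s' (bits (s.reg r) + c)
  | ite_neg {r : ℕ} {p q : Prog} {s s' : State} {c : ℕ} :
      s.reg r ≤ 0 → Runs q s s' c → Runs (.ite r p q) s s' (bits (s.reg r) + c)
  | loop_done {r : ℕ} {p : Prog} {s : State} :
      s.reg r ≤ 0 → Runs (.loop r p) s s (bits (s.reg r))
  | loop_step {r : ℕ} {p : Prog} {s s' s'' : State} {c c' : ℕ} :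
      0 < s.reg r → Runs p s s' c → Runs (.loop r p) s' s'' c' →
      Runs (.loop r p) s s'' (bits (s.reg r) + c + c')

/-- The input: `n`, followed by the numerator and the denominator of each `λ_k`, `k = 0,…,n`. -/
def inputList (n : ℕ) (num den : Fin (n + 1) → ℕ) : List ℤ :=
  (n : ℤ) :: (List.ofFn fun k => [(num k : ℤ), (den k : ℤ)]).flatten

/-- The initial state: the input is in the memory cells `0, 1, 2, …`, all else is zero. -/
def initState (inp : List ℤ) : State where
  reg := fun _ => 0
  mem := fun a => if 0 ≤ a then inp.getD a.toNat 0 else 0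
  out := []

/-- `n + ∑ c_k`, where `c_k` is the larger of the bit lengths of the numerator and the
denominator of `λ_k`. -/
def inputSize (n : ℕ) (num den : Fin (n + 1) → ℕ) : ℕ :=
  n + ∑ k, max (num k).size (den k).size

end CalibratedSignaling

end

/-! The optimality proof is linear programming duality. Calibration makes `E[(o_i - x_i) g(x_i)]`
vanish for every bounded measurable `g`, so such terms can be added to the revenue for free.

Primal side. After `k ≥ 2` clicks, two random clickers bid `1`, and the other `k - 2` clickers are
surplus; the expected surplus is `A`. Surplus clickers make positive bids credible when fewer than
two bidders click: after one click the clicker and a random non-clicker share the bid `t₁`, after no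
click two random bidders share `t₀`, and all other non-clickers bid `0`. If surplus mass `x` is
pooled with `t₁` and `A - x` with `t₀`, calibration forces `t₁ = (λ₁ + x)/(2λ₁ + x)` and `t₀ = (A -
x)/(2λ₀ + A - x)`. In `λ₁ t₁ + λ₀ t₀` the marginal values of surplus at the two bids are `(1 - t₁)²`
and `(1 - t₀)²/2`. They agree when `1 - t₀ = √2 (1 - t₁)`; this, or the corner `x = 0`, determines
`xStar` (`threshold_cases`). `calibrated_optimalSignaling` checks calibration.

Dual side. Put `a = (1 - t₀)²/2`, the shadow price of a surplus click, and let the price of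
miscalibration at signal `x` be `a/(1 - x)`, capped at `1/2`. `secmax_add_price_le` bounds `secmax x
+ ∑ (o_i - x_i) price(x_i)` for each single `o` and `x` by a number that depends only on the click
count. By `dualValue_eq` these numbers average to the revenue of the construction, so `revenue_le`
is tight.

Computation. After scaling to integers, the case distinction is the sign of an integer, and
thresholds and lottery weights have closed forms in `ℚ(√2)`. The program adds up `A` as an unreduced
fraction and prints two weighted profiles per click count. Its time bound rests on one uniform bound
for the bit lengths in the ten working registers and in memory (`Exec`, `exec_mainProg`,
`mainProg_correct`). -/

namespace CalibratedSignaling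

/-! ### The thresholds -/

section Thresholds

variable {n : ℕ} {L : ℕ → ℝ}

theorem xStar_nonneg : 0 ≤ xStar n L := le_max_right _ _

theorem one_lt_sqrt_two : (1 : ℝ) < √2 := by
  rw [Real.lt_sqrt] <;> norm_num

theorem sqrt_two_lt : √2 < (3 / 2 : ℝ) := by
  rw [Real.sqrt_lt'] <;> norm_num

theorem sqrt_two_mul_self : √2 * √2 = (2 : ℝ) := Real.mul_self_sqrt (by norm_num)

/-- Strictness leaves surplus for the no-click bid: it gives `tZero > 0` and the condition `l n > 0`
of the linear system. -/
theorem xStar_lt_excess (h0 : 0 < L 0) (h1 : 0 < L 1) (hA : 0 < excess n L) :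
    xStar n L < excess n L := by
  have hs := one_lt_sqrt_two
  refine max_lt ?_ hA
  rw [div_lt_iff₀ (by positivity)]
  have : 0 < √2 * L 0 * excess n L := by positivity
  have : 0 < L 1 * L 0 * (√2 - 1) := mul_pos (mul_pos h1 h0) (by linarith)
  nlinarith

/-- Either the unconstrained optimum is interior, or the constraint `0 ≤ x` binds. -/
theorem xStar_cases (h0 : 0 < L 0) (h1 : 0 < L 1) :
    (xStar n L = 0 ∧ excess n L + 2 * L 0 * (1 - √2) ≤ 0) ∨
      (0 < excess n L + 2 * L 0 * (1 - √2) ∧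
        xStar n L * (L 1 + √2 * L 0) = L 1 * (excess n L + 2 * L 0 * (1 - √2))) := by
  have hd : 0 < L 1 + √2 * L 0 := by positivity
  have he : L 1 * excess n L + 2 * L 1 * L 0 * (1 - √2) =
      L 1 * (excess n L + 2 * L 0 * (1 - √2)) := by ring
  rcases le_or_gt (excess n L + 2 * L 0 * (1 - √2)) 0 with h | h
  · refine .inl ⟨max_eq_right ?_, h⟩
    rw [he]
    exact div_nonpos_of_nonpos_of_nonneg (mul_nonpos_of_nonneg_of_nonpos h1.le h) hd.le
  · refine .inr ⟨h, ?_⟩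
    unfold xStar
    rw [max_eq_left, he, div_mul_cancel₀ _ hd.ne']
    rw [he]
    positivity

theorem tOne_mul (h1 : 0 < L 1) :
    tOne n L * (2 * L 1 + xStar n L) = L 1 + xStar n L := by
  have := xStar_nonneg (n := n) (L := L)
  exact div_mul_cancel₀ _ (by positivity)

theorem tZero_mul (h0 : 0 < L 0) (h1 : 0 < L 1) (hA : 0 < excess n L) :
    tZero n L * (2 * L 0 + (excess n L - xStar n L)) = excess n L - xStar n L := by
  have := xStar_lt_excess h0 h1 hA
  exact div_mul_cancel₀ _ (by linarith)

theorem tOne_mem_Ico (h1 : 0 < L 1) : tOne n L ∈ Set.Ico (1 / 2 : ℝ) 1 := by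
  have := xStar_nonneg (n := n) (L := L)
  have hd : 0 < 2 * L 1 + xStar n L := by positivity
  constructor
  · rw [tOne, div_le_div_iff₀ (by norm_num) hd]; linarith
  · rw [tOne, div_lt_one hd]; linarith

theorem tZero_pos (h0 : 0 < L 0) (h1 : 0 < L 1) (hA : 0 < excess n L) : 0 < tZero n L := by
  have := xStar_lt_excess h0 h1 hA
  exact div_pos (by linarith) (by linarith)

/-- The first-order conditions that link the two thresholds. -/
theorem threshold_cases (h0 : 0 < L 0) (h1 : 0 < L 1) (hA : 0 < excess n L) :
    (tOne n L = 1 / 2 ∧ 1 ≤ √2 * (1 - tZero n L)) ∨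
      1 - tZero n L = √2 * (1 - tOne n L) := by
  have hs := one_lt_sqrt_two
  have hss := sqrt_two_mul_self
  have hX := xStar_nonneg (n := n) (L := L)
  have hXA := xStar_lt_excess h0 h1 hA
  have hd1 : 0 < 2 * L 1 + xStar n L := by positivity
  have hd0 : 0 < 2 * L 0 + (excess n L - xStar n L) := by linarith
  have e0 : 1 - tZero n L = 2 * L 0 / (2 * L 0 + (excess n L - xStar n L)) := by
    rw [tZero]; field_simp; ring
  have e1 : 1 - tOne n L = L 1 / (2 * L 1 + xStar n L) := by
    rw [tOne]; field_simp; ring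
  rcases xStar_cases (n := n) h0 h1 with ⟨hx, h⟩ | ⟨h, hx⟩
  · left
    constructor
    · rw [tOne, hx]; field_simp; ring
    · rw [e0, ← mul_div_assoc, le_div_iff₀ hd0, hx]
      nlinarith
  · right
    rw [e0, e1, ← mul_div_assoc, div_eq_div_iff hd0.ne' hd1.ne']
    linear_combination (√2) * hx - L 0 * (xStar n L + 2 * L 1) * hss

/-- At the corner, `√2 < 3/2` gives `t₀ < 1/3 < t₁`. In the interior, `1 - t₀` is `√2 > 1` times `1
- t₁`. -/
theorem tZero_le_tOne (h0 : 0 < L 0) (h1 : 0 < L 1) (hA : 0 < excess n L) :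
    tZero n L ≤ tOne n L := by
  have hs := one_lt_sqrt_two
  have ht := tOne_mem_Ico (n := n) h1
  rcases threshold_cases h0 h1 hA with ⟨h, h'⟩ | h
  · rw [h]; nlinarith [sqrt_two_lt]
  · nlinarith [ht.2]

theorem exists_linSys (h0 : 0 < L 0) (h1 : 0 < L 1) (hA : 0 < excess n L) (hn : 3 ≤ n) :
    ∃ m l : ℕ → ℝ, LinSys n L m l := by
  have hXA := xStar_lt_excess h0 h1 hA
  have hX := xStar_nonneg (n := n) (L := L)
  -- The proportional solution: for every `k` the same fraction `θ` of the surplus clickers goes to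
  -- `t₁`. The optimal signaling realizes it, with `θ` as a lottery probability (`poolProb`).
  set θ := xStar n L / excess n L with hθ
  have hθ0 : 0 ≤ θ := by positivity
  have hθ1 : θ < 1 := by rw [hθ, div_lt_one hA]; exact hXA
  have hk : ∀ k ∈ Icc 2 n, (0 : ℝ) < k ∧ (0 : ℝ) ≤ k - 2 := fun k hk => by
    have : (2 : ℝ) ≤ k := by exact_mod_cast (mem_Icc.1 hk).1
    constructor <;> linarith
  have key : ∀ c : ℝ, ∑ k ∈ Icc 2 n, L k * (k * (c * (((k : ℝ) - 2) / k))) = c * excess n L := by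
    intro c
    rw [excess, mul_sum]
    refine sum_congr rfl fun k h => ?_
    have := (hk k h).1
    field_simp
  refine ⟨fun k => θ * (((k : ℝ) - 2) / k), fun k => (1 - θ) * (((k : ℝ) - 2) / k), ?_, ?_, ?_, ?_, ?_⟩
  · have : (3 : ℝ) ≤ n := by exact_mod_cast hn
    exact mul_pos (by linarith) (div_pos (by linarith) (by linarith))
  · intro k h
    obtain ⟨a, b⟩ := hk k h
    have : 0 ≤ 1 - θ := by linarith
    constructor <;> positivity
  · intro k _; ring
  · rw [key, hθ, div_mul_cancel₀ _ hA.ne']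
  · rw [key, key]; ring

theorem LinSys.thresholds {m l : ℕ → ℝ} (h : LinSys n L m l) :
    tOne n L = (L 1 + ∑ k ∈ Icc 2 n, L k * (k * m k)) /
        (2 * L 1 + ∑ k ∈ Icc 2 n, L k * (k * m k)) ∧
      tZero n L = (∑ k ∈ Icc 2 n, L k * (k * l k)) /
        (2 * L 0 + ∑ k ∈ Icc 2 n, L k * (k * l k)) := by
  have e : ∑ k ∈ Icc 2 n, L k * (k * l k) = excess n L - xStar n L := by
    rw [← h.sum_all, h.sum_m]; ring
  rw [h.sum_m, e]
  exact ⟨rfl, rfl⟩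

end Thresholds

/-! ### Dual prices -/

section Dual

/-- The dual price of miscalibration at signal `x`. -/
noncomputable def price (a x : ℝ) : ℝ := if x ≤ 1 - 2 * a then a / (1 - x) else 1 / 2

theorem measurable_price (a : ℝ) : Measurable (price a) :=
  Measurable.ite measurableSet_Iic (by fun_prop) measurable_const

variable {a x y : ℝ}

theorem price_mem (ha : 0 < a) (x : ℝ) : price a x ∈ Set.Icc 0 (1 / 2) := by
  unfold price
  split_ifs with h
  · have : 0 < 1 - x := by linarith
    exact ⟨by positivity, by rw [div_le_iff₀ this]; linarith⟩
  · norm_num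

/-- No click earns more than the shadow price `a` of a surplus click: `(1 - x) * price` equals `a`
up to `1 - 2a`, and the cap keeps it below `a` afterwards. -/
theorem click_price_le (ha : 0 < a) : (1 - x) * price a x ≤ a := by
  unfold price
  split_ifs with h
  · rw [mul_div_cancel₀ _ (by linarith)]
  · linarith

/-- With `noclick_price_antitone`, this allows the two highest bids to be lowered to the
second-highest one without decreasing the dual expression. -/
theorem click_price_antitone (ha : 0 < a) (hyx : y ≤ x) :
    (1 - x) * price a x ≤ (1 - y) * price a y := by
  unfold price
  split_ifs with h h' h'
  · rw [mul_div_cancel₀ _ (by linarith), mul_div_cancel₀ _ (by linarith)]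
  · linarith
  · rw [mul_div_cancel₀ _ (by linarith)]; linarith
  · linarith

theorem price_mono (ha : 0 < a) (hyx : y ≤ x) : price a y ≤ price a x := by
  have := (price_mem ha y).2
  unfold price at *
  split_ifs with h h' h'
  · exact div_le_div_of_nonneg_left ha.le (by linarith) (by linarith)
  · rwa [if_pos h] at this
  · linarith
  · exact le_rfl

theorem noclick_price_antitone (ha : 0 < a) (hy : 0 ≤ y) (hyx : y ≤ x) :
    y * price a y ≤ x * price a x :=
  mul_le_mul hyx (price_mono ha hyx) (price_mem ha y).1 (hy.trans hyx)

variable {t₀ t₁ : ℝ}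

/-- This inequality is the reason for the cap `1/2` on the price. -/
theorem two_clicks_le (ha : 0 < a) (hx : x ≤ 1) : x + 2 * ((1 - x) * price a x) ≤ 1 := by
  nlinarith [(price_mem ha x).2]

/-- The value of `a` makes the slack on the first branch `(x - t₀)²/(1 - x)`, so the bound is tight
at the bid in use. Under the cap the left side is zero. -/
theorem no_click_le (ha : a = (1 - t₀) ^ 2 / 2) (ht : t₀ < 1) :
    x - 2 * (x * price a x) ≤ t₀ ^ 2 := by
  have : 0 < (1 - t₀) ^ 2 := by have : 0 < 1 - t₀ := by linarith
                                positivity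
  unfold price
  split_ifs with h
  · have hr : 0 < 1 - x := by linarith
    have e : t₀ ^ 2 - (x - 2 * (x * (a / (1 - x)))) = (x - t₀) ^ 2 / (1 - x) := by
      subst ha; field_simp; ring
    have : 0 ≤ (x - t₀) ^ 2 / (1 - x) := by positivity
    linarith
  · nlinarith [sq_nonneg t₀]

/-- In the interior case `a = (1 - t₁)²`, and the slack is `(x - t₁)²/(1 - x)`. At the corner `a ≥
1/4` confines the first branch to `x ≤ 1/2`, where both factors of the slack are nonnegative. Under
the cap the left side is `1/2`, the minimum of `1 - 2t(1 - t)`. -/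
theorem one_click_le (ha : a = (1 - t₀) ^ 2 / 2) (ht : t₀ < 1) (ht1 : 1 / 2 ≤ t₁)
    (h : (t₁ = 1 / 2 ∧ 1 ≤ √2 * (1 - t₀)) ∨ 1 - t₀ = √2 * (1 - t₁)) :
    x + (1 - x) * price a x - x * price a x ≤ 1 - 2 * t₁ * (1 - t₁) := by
  have hss := sqrt_two_mul_self
  have h0 : 0 < 1 - t₀ := by linarith
  have ha' : 0 < a := by rw [ha]; positivity
  unfold price
  split_ifs with hx
  · have hr : 0 < 1 - x := by linarith
    rcases h with ⟨h, h'⟩ | h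
    · have h4 : 1 / 4 ≤ a := by
        have : 1 ≤ (√2 * (1 - t₀)) ^ 2 := one_le_pow₀ h'
        rw [ha]; nlinarith
      have e : 1 - 2 * t₁ * (1 - t₁) - (x + (1 - x) * (a / (1 - x)) - x * (a / (1 - x))) =
          (1 - 2 * x) * ((1 - x) / 2 - a) / (1 - x) := by
        subst h; field_simp; ring
      have : 0 ≤ (1 - 2 * x) * ((1 - x) / 2 - a) / (1 - x) :=
        div_nonneg (mul_nonneg (by linarith) (by linarith)) hr.le
      linarith
    · have ha2 : a = (1 - t₁) ^ 2 := by rw [ha, h]; linear_combination ((1 - t₁) ^ 2 / 2) * hss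
      have e : 1 - 2 * t₁ * (1 - t₁) - (x + (1 - x) * (a / (1 - x)) - x * (a / (1 - x))) =
          (x - t₁) ^ 2 / (1 - x) := by
        rw [ha2]; field_simp; ring
      have : 0 ≤ (x - t₁) ^ 2 / (1 - x) := by positivity
      linarith
  · nlinarith [sq_nonneg (2 * t₁ - 1)]

/-- The dual value of an outcome profile with `k` clicks. -/
noncomputable def dualValue (t₀ t₁ : ℝ) (k : ℕ) : ℝ :=
  if 2 ≤ k then 1 + ((k : ℝ) - 2) * ((1 - t₀) ^ 2 / 2)
  else if k = 1 then 1 - 2 * t₁ * (1 - t₁) else t₀ ^ 2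

/-- A clicker in the top pair is worth at least `a`, the most it can earn outside. This covers the
profiles whose top pair contains fewer clickers than it could. -/
theorem dualValue_bounds (ht0 : 0 < t₀) (ht : t₀ < 1) (ht1 : 1 / 2 ≤ t₁) (ht1' : t₁ < 1)
    (h : (t₁ = 1 / 2 ∧ 1 ≤ √2 * (1 - t₀)) ∨ 1 - t₀ = √2 * (1 - t₁)) :
    t₀ ^ 2 + (1 - t₀) ^ 2 / 2 ≤ 1 - 2 * t₁ * (1 - t₁) ∧
      1 - 2 * t₁ * (1 - t₁) + (1 - t₀) ^ 2 / 2 ≤ 1 := by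
  have hss := sqrt_two_mul_self
  have hs := one_lt_sqrt_two
  have hs' := sqrt_two_lt
  rcases h with ⟨h, h'⟩ | h
  · have : t₀ ≤ 1 / 3 := by nlinarith
    subst h
    constructor <;> nlinarith
  · have e : (1 - t₀) ^ 2 = 2 * (1 - t₁) ^ 2 := by
      rw [h]; linear_combination ((1 - t₁) ^ 2) * hss
    have e0 : t₀ = 1 - √2 * (1 - t₁) := by linarith
    -- The estimate below needs `1 - t₁ ≤ 1/2 ≤ 2(√2 - 1)`, for which `1 < √2` is too weak.
    have hs2 : (1.4 : ℝ) < √2 := by rw [Real.lt_sqrt] <;> norm_num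
    constructor
    · rw [e, e0]
      have : 0 ≤ (1 - t₁) * (2 * (√2 - 1) - (1 - t₁)) := mul_nonneg (by linarith) (by linarith)
      nlinarith
    · rw [e]; nlinarith

theorem dualValue_two_clicks (k : ℕ) (hk : 2 ≤ k) :
    dualValue t₀ t₁ k = 1 + ((k : ℝ) - 2) * ((1 - t₀) ^ 2 / 2) := if_pos hk

/-- Weak duality for one outcome profile. -/
theorem secmax_add_price_le {n : ℕ} (hn : 2 ≤ n) (ht0 : 0 < t₀) (ht : t₀ < 1) (ht1 : 1 / 2 ≤ t₁)
    (ht1' : t₁ < 1) (h : (t₁ = 1 / 2 ∧ 1 ≤ √2 * (1 - t₀)) ∨ 1 - t₀ = √2 * (1 - t₁))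
    (o : Outcome n) (x : Fin n → ℝ) (hx : ∀ i, x i ∈ Set.Icc (0 : ℝ) 1) :
    secmax x + ∑ i, ((if o i = true then (1 : ℝ) else 0) - x i) *
      price ((1 - t₀) ^ 2 / 2) (x i) ≤ dualValue t₀ t₁ (clicks o) := by
  obtain ⟨a, ha⟩ : ∃ a, a = (1 - t₀) ^ 2 / 2 := ⟨_, rfl⟩
  obtain ⟨hb0, hb1⟩ := dualValue_bounds ht0 ht ht1 ht1' h
  rw [← ha] at hb0 hb1
  have ha0 : 0 < a := by
    have : 0 < 1 - t₀ := by linarith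
    rw [ha]; positivity
  obtain ⟨i, j, hij, hi, hj⟩ : ∃ i j : Fin n, i ≠ j ∧ secmax x ≤ x i ∧ secmax x ≤ x j := by
    have : Nonempty {p : Fin n × Fin n // p.1 ≠ p.2} :=
      ⟨⟨(⟨0, by omega⟩, ⟨1, by omega⟩), by simp⟩⟩
    obtain ⟨p, hp⟩ := exists_eq_ciSup_of_finite
      (f := fun p : {p : Fin n × Fin n // p.1 ≠ p.2} => min (x p.1.1) (x p.1.2))
    refine ⟨p.1.1, p.1.2, p.2, ?_, ?_⟩ <;> rw [secmax, ← hp]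
    exacts [min_le_left _ _, min_le_right _ _]
  have hy0 : 0 ≤ secmax x := Real.iSup_nonneg fun p => le_min (hx _).1 (hx _).1
  have hy1 : secmax x ≤ 1 := hi.trans (hx i).2
  rw [← ha]
  set y := secmax x with hy
  set φ : Fin n → ℝ := fun i => ((if o i = true then (1 : ℝ) else 0) - x i) * price a (x i) with hφ
  have hle : ∀ l, φ l ≤ if o l = true then a else 0 := by
    intro l
    by_cases hl : o l = true
    · simpa [hφ, hl] using click_price_le (x := x l) ha0
    · simpa [hφ, hl] using mul_nonneg (hx l).1 (price_mem ha0 (x l)).1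
  have htop : ∀ l, y ≤ x l → φ l ≤ if o l = true then (1 - y) * price a y else -(y * price a y) := by
    intro l hyl
    by_cases hl : o l = true
    · simpa [hφ, hl] using click_price_antitone ha0 hyl
    · simpa [hφ, hl] using noclick_price_antitone ha0 hy0 hyl
  have hsum : ∑ l, φ l ≤ φ i + φ j +
      (a * clicks o - (if o i = true then a else 0) - (if o j = true then a else 0)) := by
    have e1 : ∀ f : Fin n → ℝ, ∑ l, f l = f i + f j + ∑ l ∈ (univ.erase i).erase j, f l := by
      intro f
      rw [← add_sum_erase univ f (mem_univ i), ← add_sum_erase (univ.erase i) f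
        (mem_erase.2 ⟨hij.symm, mem_univ j⟩), add_assoc]
    have e2 : a * clicks o = ∑ l, if o l = true then a else 0 := by
      rw [← sum_filter, sum_const, clicks, nsmul_eq_mul, mul_comm]
    rw [e2, e1 φ, e1 fun l => if o l = true then a else 0]
    have := sum_le_sum fun l (_ : l ∈ (univ.erase i).erase j) => hle l
    linarith
  have b2 := two_clicks_le ha0 hy1
  have b1 := one_click_le (x := y) ha ht ht1 h
  have b0 := no_click_le (x := y) ha ht
  have hi' := htop i hi
  have hj' := htop j hj
  have hcard : ∀ l, o l = true → 1 ≤ clicks o := fun l hl =>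
    card_pos.2 ⟨l, by simpa using hl⟩
  have hcard2 : o i = true → o j = true → 2 ≤ clicks o := fun h1 h2 => by
    rw [clicks, ← card_pair hij]
    exact card_le_card fun l hl => by
      rcases mem_insert.1 hl with rfl | hl
      · simpa using h1
      · rw [mem_singleton.1 hl]; simpa using h2
  unfold dualValue
  rw [← ha]
  -- The clickers in the pair `i`, `j` decide between `b2`, `b1` and `b0`; every other clicker adds
  -- at most `a`, and `hb0`, `hb1` absorb this when the pair has too few clickers.
  rcases Nat.lt_or_ge (clicks o) 2 with hk | hk
  · rw [if_neg (by omega)]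
    rcases (by omega : clicks o = 1 ∨ clicks o = 0) with hk1 | hk0
    · rw [if_pos hk1]
      rw [hk1] at hsum
      by_cases oi : o i = true <;> by_cases oj : o j = true
      · have := hcard2 oi oj; omega
      all_goals simp only [oi, oj, if_true] at hi' hj' hsum; push_cast at hsum; norm_num at hi' hj' hsum; linarith
    · rw [if_neg (by omega)]
      have oi : o i ≠ true := fun h => by have := hcard i h; omega
      have oj : o j ≠ true := fun h => by have := hcard j h; omega
      rw [hk0] at hsum
      simp only [oi, oj] at hi' hj' hsum; norm_num at hi' hj' hsum; linarith
  · rw [if_pos hk]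
    by_cases oi : o i = true <;> by_cases oj : o j = true <;>
      (simp only [oi, oj, if_true] at hi' hj' hsum; norm_num at hi' hj' hsum; linarith)

theorem dualValue_eq {n : ℕ} {L : ℕ → ℝ} (h0 : 0 < L 0) (h1 : 0 < L 1) (hA : 0 < excess n L) :
    (1 - tZero n L) ^ 2 / 2 * excess n L + L 1 * (1 - 2 * tOne n L * (1 - tOne n L)) +
      L 0 * tZero n L ^ 2 = L 1 * tOne n L + L 0 * tZero n L := by
  have hss := sqrt_two_mul_self
  have e1 := tOne_mul (n := n) h1
  have e0 := tZero_mul h0 h1 hA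
  -- Complementary slackness: both sides vanish at the corner, and in the interior `(1 - t₀)²/2 = (1
  -- - t₁)²`.
  have hX : (1 - tZero n L) ^ 2 / 2 * xStar n L = L 1 * (1 - tOne n L) * (2 * tOne n L - 1) := by
    rcases xStar_cases (n := n) h0 h1 with ⟨hx, -⟩ | ⟨-, hx⟩
    · have : tOne n L = 1 / 2 := by
        rw [hx] at e1
        have : L 1 * (2 * tOne n L - 1) = 0 := by linarith
        rcases mul_eq_zero.1 this with h | h <;> linarith
      rw [hx, this]; ring
    · rcases threshold_cases h0 h1 hA with ⟨h, -⟩ | h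
      · have : xStar n L = 0 := by rw [h] at e1; linarith
        rw [h, this]; ring
      · rw [h]
        linear_combination (1 - tOne n L) ^ 2 / 2 * xStar n L * hss - (1 - tOne n L) * e1
  linear_combination hX - (1 - tZero n L) / 2 * e0

end Dual

/-! ### Expectations under the joint law; the upper bound on the revenue -/

section Joint

variable {n : ℕ} (lam : Prior n) (π : Signaling n)

instance (o : Outcome n) : IsProbabilityMeasure (π.law o) := π.isProb o

instance : IsFiniteMeasure (joint lam π) := by
  unfold joint
  have : ∀ o, IsFiniteMeasure (ENNReal.ofReal (lam.prob o) • (Measure.dirac o).prod (π.law o)) :=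
    fun o => Measure.smul_finite _ ENNReal.ofReal_ne_top
  infer_instance

variable {lam π}

theorem integrable_law {f : (Fin n → ℝ) → ℝ} (hf : Measurable f) {C : ℝ}
    (hC : ∀ x, (∀ i, x i ∈ Set.Icc (0 : ℝ) 1) → ‖f x‖ ≤ C) (o : Outcome n) :
    Integrable f (π.law o) :=
  Integrable.of_bound hf.aestronglyMeasurable C ((π.mem_unit o).mono fun x hx => hC x hx)

theorem ae_joint {p : Outcome n × (Fin n → ℝ) → Prop} (hp : MeasurableSet {w | p w})
    (h : ∀ o x, (∀ i, x i ∈ Set.Icc (0 : ℝ) 1) → p (o, x)) : ∀ᵐ w ∂joint lam π, p w := by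
  rw [joint, ae_finsetSum_measure_iff]
  intro o _
  refine Measure.ae_smul_measure ?_ _
  rw [Measure.dirac_prod, ae_map_iff measurable_prodMk_left.aemeasurable hp]
  exact (π.mem_unit o).mono fun x hx => h o x hx

theorem integrable_joint {f : Outcome n × (Fin n → ℝ) → ℝ} (hf : Measurable f) {C : ℝ}
    (hC : ∀ o x, (∀ i, x i ∈ Set.Icc (0 : ℝ) 1) → ‖f (o, x)‖ ≤ C) :
    Integrable f (joint lam π) :=
  Integrable.of_bound hf.aestronglyMeasurable C
    (ae_joint (measurableSet_le hf.norm measurable_const) hC)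

theorem integral_joint {f : Outcome n × (Fin n → ℝ) → ℝ} (hf : Measurable f) {C : ℝ}
    (hC : ∀ o x, (∀ i, x i ∈ Set.Icc (0 : ℝ) 1) → ‖f (o, x)‖ ≤ C) :
    ∫ w, f w ∂joint lam π = ∑ o, lam.prob o * ∫ x, f (o, x) ∂π.law o := by
  have hi : ∀ o, Integrable f ((Measure.dirac o).prod (π.law o)) := by
    intro o
    rw [Measure.dirac_prod, integrable_map_measure hf.aestronglyMeasurable
      measurable_prodMk_left.aemeasurable]
    exact integrable_law (hf.comp measurable_prodMk_left) (hC o) o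
  rw [joint, integral_finsetSum_measure fun o _ => (hi o).smul_measure ENNReal.ofReal_ne_top]
  refine sum_congr rfl fun o _ => ?_
  rw [integral_smul_measure, ENNReal.toReal_ofReal (lam.nonneg o), Measure.dirac_prod,
    integral_map measurable_prodMk_left.aemeasurable hf.aestronglyMeasurable, smul_eq_mul]

theorem measurable_click (i : Fin n) :
    Measurable fun w : Outcome n × (Fin n → ℝ) => if w.1 i = true then (1 : ℝ) else 0 :=
  (measurable_of_finite fun o : Outcome n => if o i = true then (1 : ℝ) else 0).comp measurable_fst

theorem measurable_bid (i : Fin n) : Measurable fun w : Outcome n × (Fin n → ℝ) => w.2 i :=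
  (measurable_pi_apply i).comp measurable_snd

theorem norm_miscalibration_le {c x p C : ℝ} (hc : c = 0 ∨ c = 1) (hx : x ∈ Set.Icc (0 : ℝ) 1)
    (hp : |p| ≤ C) : ‖(c - x) * p‖ ≤ C := by
  rw [norm_mul, Real.norm_eq_abs, Real.norm_eq_abs]
  have : |c - x| ≤ 1 := by
    rw [abs_le]; rcases hc with rfl | rfl <;> constructor <;> linarith [hx.1, hx.2]
  calc _ ≤ 1 * C := mul_le_mul this hp (abs_nonneg _) zero_le_one
    _ = C := one_mul C

theorem integral_joint_miscalibration {g : ℝ → ℝ} (hg : Measurable g) {C : ℝ}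
    (hC : ∀ x, |g x| ≤ C) (i : Fin n) :
    Integrable (fun w : Outcome n × (Fin n → ℝ) =>
        ((if w.1 i = true then (1 : ℝ) else 0) - w.2 i) * g (w.2 i)) (joint lam π) ∧
      ∫ w, ((if w.1 i = true then (1 : ℝ) else 0) - w.2 i) * g (w.2 i) ∂joint lam π =
        ∑ o, lam.prob o *
          ∫ x, ((if o i = true then (1 : ℝ) else 0) - x i) * g (x i) ∂π.law o := by
  have hm : Measurable fun w : Outcome n × (Fin n → ℝ) =>
      ((if w.1 i = true then (1 : ℝ) else 0) - w.2 i) * g (w.2 i) :=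
    ((measurable_click i).sub (measurable_bid i)).mul (hg.comp (measurable_bid i))
  have hb : ∀ (o : Outcome n) (x : Fin n → ℝ), (∀ i, x i ∈ Set.Icc (0 : ℝ) 1) →
      ‖((if o i = true then (1 : ℝ) else 0) - x i) * g (x i)‖ ≤ C := fun o x hx =>
    norm_miscalibration_le (by split_ifs <;> simp) (hx i) (hC _)
  exact ⟨integrable_joint hm hb, integral_joint hm hb⟩

/-- Under calibration, no price function of the own signal earns from miscalibration. -/
theorem Calibrated.sum_integral_eq_zero (h : Calibrated lam π) {g : ℝ → ℝ} (hg : Measurable g)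
    {C : ℝ} (hC : ∀ x, |g x| ≤ C) (i : Fin n) :
    ∑ o, lam.prob o *
      ∫ x, ((if o i = true then (1 : ℝ) else 0) - x i) * g (x i) ∂π.law o = 0 := by
  obtain ⟨hint, heq⟩ := integral_joint_miscalibration (lam := lam) (π := π) hg hC i
  rw [← heq]
  set m : MeasurableSpace (Outcome n × (Fin n → ℝ)) :=
    MeasurableSpace.comap (fun w : Outcome n × (Fin n → ℝ) => w.2 i) inferInstance with hm
  have hle := (measurable_bid (n := n) i).comap_le
  have hbm : Measurable[m] fun w : Outcome n × (Fin n → ℝ) => w.2 i := comap_measurable _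
  have hgm : StronglyMeasurable[m] fun w : Outcome n × (Fin n → ℝ) => g (w.2 i) :=
    (hg.comp hbm).stronglyMeasurable
  have hclick : Integrable (fun w : Outcome n × (Fin n → ℝ) =>
      if w.1 i = true then (1 : ℝ) else 0) (joint lam π) :=
    integrable_joint (C := 1) (measurable_click i) fun o x _ => by
      dsimp only; split_ifs <;> simp
  have hbid : Integrable (fun w : Outcome n × (Fin n → ℝ) => w.2 i) (joint lam π) :=
    integrable_joint (C := 1) (measurable_bid i) fun o x hx => by
      rw [Real.norm_eq_abs, abs_of_nonneg (hx i).1]; exact (hx i).2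
  set f : Outcome n × (Fin n → ℝ) → ℝ := (fun w => if w.1 i = true then (1 : ℝ) else 0) -
    fun w => w.2 i with hf
  -- The price is a function of the own signal, so it leaves the conditional expectation; the
  -- remaining factor `E[o_i - x_i | x_i]` is zero by calibration.
  have hpull : (joint lam π)[f * (fun w => g (w.2 i)) | m] =ᵐ[joint lam π]
      (joint lam π)[f | m] * fun w => g (w.2 i) :=
    condExp_mul_of_stronglyMeasurable_right hgm hint (hclick.sub hbid)
  have hzero : (joint lam π)[f | m] =ᵐ[joint lam π] 0 := by
    have h1 := condExp_sub hclick hbid m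
    rw [condExp_of_stronglyMeasurable hle hbm.stronglyMeasurable hbid] at h1
    filter_upwards [h1, h i] with w h1 h2
    rw [h1, Pi.sub_apply, h2]; simp
  change ∫ w, (f * fun w : Outcome n × (Fin n → ℝ) => g (w.2 i) : _ → ℝ) w ∂joint lam π = 0
  rw [← integral_condExp hle]
  refine (integral_congr_ae (g := fun _ => (0 : ℝ)) ?_).trans (integral_zero _ _)
  filter_upwards [hpull, hzero] with w h1 h2
  rw [h1, Pi.mul_apply, h2]; simp

/-- The events generated by `x_i` are the preimages of Borel sets, so indicators of own signals
suffice as test functions to identify the conditional expectation. -/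
theorem calibrated_of_sum_integral_eq_zero
    (h : ∀ (i : Fin n) (B : Set ℝ), MeasurableSet B →
      ∑ o, lam.prob o * ∫ x, ((if o i = true then (1 : ℝ) else 0) - x i) *
        B.indicator 1 (x i) ∂π.law o = 0) : Calibrated lam π := by
  intro i
  have hle := (measurable_bid (n := n) i).comap_le
  have hclick : Integrable (fun w : Outcome n × (Fin n → ℝ) =>
      if w.1 i = true then (1 : ℝ) else 0) (joint lam π) :=
    integrable_joint (C := 1) (measurable_click i) fun o x _ => by
      dsimp only; split_ifs <;> simp
  have hbid : Integrable (fun w : Outcome n × (Fin n → ℝ) => w.2 i) (joint lam π) :=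
    integrable_joint (C := 1) (measurable_bid i) fun o x hx => by
      rw [Real.norm_eq_abs, abs_of_nonneg (hx i).1]; exact (hx i).2
  symm
  refine ae_eq_condExp_of_forall_setIntegral_eq hle hclick (fun s _ _ => hbid.integrableOn) ?_
    ((comap_measurable _).stronglyMeasurable.aestronglyMeasurable)
  rintro _ ⟨B, hB, rfl⟩ -
  have hg : Measurable (B.indicator (1 : ℝ → ℝ)) := measurable_one.indicator hB
  obtain ⟨hint, heq⟩ := integral_joint_miscalibration (lam := lam) (π := π) hg (C := 1)
    (fun x => by by_cases hx : x ∈ B <;> simp [hx]) i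
  rw [h i B hB] at heq
  have hS : MeasurableSet ((fun w : Outcome n × (Fin n → ℝ) => w.2 i) ⁻¹' B) := measurable_bid i hB
  symm
  rw [← sub_eq_zero, ← integral_sub hclick.integrableOn hbid.integrableOn,
    ← integral_indicator hS]
  refine Eq.trans ?_ heq
  refine integral_congr_ae (.of_forall fun w => ?_)
  by_cases hw : w.2 i ∈ B <;> simp [Set.indicator, hw]

theorem measurable_secmax : Measurable (secmax (n := n)) :=
  Measurable.iSup fun _ => (measurable_pi_apply _).min (measurable_pi_apply _)

theorem secmax_mem (x : Fin n → ℝ) (hx : ∀ i, x i ∈ Set.Icc (0 : ℝ) 1) :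
    secmax x ∈ Set.Icc (0 : ℝ) 1 :=
  ⟨Real.iSup_nonneg fun _ => le_min (hx _).1 (hx _).1,
    Real.iSup_le (fun _ => (min_le_left _ _).trans (hx _).2) zero_le_one⟩

theorem sum_prob_mul_clicks (F : ℕ → ℝ) :
    ∑ o, lam.prob o * F (clicks o) = ∑ k ∈ range (n + 1), lam.level k * F k := by
  rw [← sum_fiberwise_of_maps_to (g := clicks) (t := range (n + 1))
    (fun o _ => mem_range.2 (clicks_lt o))]
  refine sum_congr rfl fun k _ => ?_
  rw [Prior.level, sum_mul]
  exact sum_congr rfl fun o ho => by rw [(mem_filter.1 ho).2]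

theorem Prior.level_nonneg (lam : Prior n) (k : ℕ) : 0 ≤ lam.level k :=
  sum_nonneg fun o _ => lam.nonneg o

theorem le_of_level_pos {k : ℕ} (h : 0 < lam.level k) : k ≤ n := by
  by_contra hk
  refine h.ne' (sum_eq_zero fun o ho => ?_)
  have := clicks_lt o
  have := (mem_filter.1 ho).2
  omega

/-- Two clicks leave no surplus; hence the assumption on some `k ≥ 3`. -/
theorem excess_level_pos {k : ℕ} (hk : 3 ≤ k) (h : 0 < lam.level k) : 0 < excess n lam.level := by
  refine sum_pos' (fun j hj => ?_) ⟨k, mem_Icc.2 ⟨by omega, le_of_level_pos h⟩, ?_⟩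
  · have : (2 : ℝ) ≤ j := by exact_mod_cast (mem_Icc.1 hj).1
    exact mul_nonneg (by linarith) (lam.level_nonneg j)
  · have : (3 : ℝ) ≤ k := by exact_mod_cast hk
    exact mul_pos (by linarith) h

theorem sum_range_eq_Icc (hn : 2 ≤ n) (F : ℕ → ℝ) :
    ∑ k ∈ range (n + 1), F k = F 0 + F 1 + ∑ k ∈ Icc 2 n, F k := by
  rw [range_eq_Ico, sum_eq_sum_Ico_succ_bot (by omega), sum_eq_sum_Ico_succ_bot (by omega),
    ← add_assoc]
  rfl

theorem revenue_le (hn : 3 ≤ n) (h0 : 0 < lam.level 0) (h1 : 0 < lam.level 1)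
    (hA : 0 < excess n lam.level) (h : Calibrated lam π) :
    revenue lam π ≤ ∑ o, lam.prob o * target n lam.level (clicks o) := by
  set L := lam.level with hL
  have ht0 := tZero_pos h0 h1 hA
  have ht1 := tOne_mem_Ico (n := n) h1
  have ht01 := tZero_le_tOne h0 h1 hA
  have hlt : tZero n L < 1 := ht01.trans_lt ht1.2
  set a := (1 - tZero n L) ^ 2 / 2 with ha
  have ha0 : 0 < a := by
    have : 0 < 1 - tZero n L := by linarith
    rw [ha]; positivity
  have hprice : ∀ x, |price a x| ≤ 1 / 2 := fun x => by
    rw [abs_of_nonneg (price_mem ha0 x).1]; exact (price_mem ha0 x).2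
  have hsec : ∀ o, Integrable secmax (π.law o) := integrable_law measurable_secmax (C := 1)
    fun x hx => by rw [Real.norm_eq_abs, abs_of_nonneg (secmax_mem x hx).1]; exact (secmax_mem x hx).2
  have hterm : ∀ (o : Outcome n) (i : Fin n), Integrable
      (fun x => ((if o i = true then (1 : ℝ) else 0) - x i) * price a (x i)) (π.law o) := by
    intro o i
    refine integrable_law (C := 1 / 2) ((measurable_const.sub (measurable_pi_apply i)).mul
      ((measurable_price a).comp (measurable_pi_apply i))) (fun x hx => ?_) o
    exact norm_miscalibration_le (by split_ifs <;> simp) (hx i) (hprice _)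
  have hzero : ∑ o, lam.prob o * ∑ i, ∫ x, ((if o i = true then (1 : ℝ) else 0) - x i) *
      price a (x i) ∂π.law o = 0 := by
    simp_rw [mul_sum]
    rw [sum_comm]
    exact sum_eq_zero fun i _ => h.sum_integral_eq_zero (measurable_price a) hprice i
  calc revenue lam π
      = ∑ o, lam.prob o * ∫ x, (secmax x + ∑ i, ((if o i = true then (1 : ℝ) else 0) - x i) *
          price a (x i)) ∂π.law o := by
        refine ((add_zero _).symm.trans (congrArg _ hzero.symm)).trans ?_
        rw [revenue, ← sum_add_distrib]
        refine sum_congr rfl fun o _ => ?_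
        rw [← mul_add, integral_add (hsec o) (integrable_finsetSum _ fun i _ => hterm o i),
          integral_finsetSum _ fun i _ => hterm o i]
    _ ≤ ∑ o, lam.prob o * dualValue (tZero n L) (tOne n L) (clicks o) := by
        refine sum_le_sum fun o _ => mul_le_mul_of_nonneg_left ?_ (lam.nonneg o)
        calc _ ≤ ∫ _, dualValue (tZero n L) (tOne n L) (clicks o) ∂π.law o := by
              refine integral_mono_ae ((hsec o).add (integrable_finsetSum _ fun i _ => hterm o i))
                (integrable_const _) ((π.mem_unit o).mono fun x hx => ?_)
              exact secmax_add_price_le (by omega) ht0 hlt ht1.1 ht1.2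
                (threshold_cases h0 h1 hA) o x hx
          _ = _ := by simp
    _ = ∑ o, lam.prob o * target n L (clicks o) := by
        rw [sum_prob_mul_clicks, sum_prob_mul_clicks, sum_range_eq_Icc (by omega),
          sum_range_eq_Icc (by omega)]
        -- From two clicks on, the dual values exceed the targets by `a` per surplus click, `a *
        -- excess` in total; `dualValue_eq` balances this against the lower dual values at zero and
        -- one click.
        have e : ∑ k ∈ Icc 2 n, L k * dualValue (tZero n L) (tOne n L) k =
            ∑ k ∈ Icc 2 n, L k * target n L k + a * excess n L := by
          rw [excess, mul_sum, ← sum_add_distrib]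
          refine sum_congr rfl fun k hk => ?_
          rw [dualValue_two_clicks k (mem_Icc.1 hk).1, target, if_pos (mem_Icc.1 hk).1]
          ring
        rw [← hL, e]
        have := dualValue_eq h0 h1 hA
        rw [← ha] at this
        simp only [dualValue, target]
        norm_num
        linarith

end Joint

/-! ### Symmetrized bid profiles -/

section Alignments

variable {n : ℕ}

theorem clicks_comp (o : Outcome n) (σ : Equiv.Perm (Fin n)) : clicks (o ∘ σ) = clicks o :=
  card_equiv σ fun i => by simp

theorem clicks_canonical {k : ℕ} (hk : k ≤ n) : clicks (canonical n k) = k := by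
  simp [clicks, canonical, Fin.card_filter_val_lt, hk]

theorem alignments_nonempty (o : Outcome n) : (alignments o).Nonempty := by
  have hcard : Fintype.card {i // o i = true} =
      Fintype.card {i // canonical n (clicks o) i = true} := by
    have h := clicks_canonical (Nat.le_of_lt_succ (clicks_lt o))
    rw [Fintype.card_subtype, Fintype.card_subtype]
    exact h.symm
  obtain ⟨e⟩ : Nonempty ({i // o i = true} ≃ {i // canonical n (clicks o) i = true}) :=
    ⟨Fintype.equivOfCardEq hcard⟩
  refine ⟨e.extendSubtype, mem_filter.2 ⟨mem_univ _, ?_⟩⟩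
  funext i
  by_cases h : o i = true
  · rw [h]; exact e.extendSubtype_mem i h
  · have := e.extendSubtype_not_mem i h
    simp only [Bool.not_eq_true] at h this
    rw [h]; exact this

theorem mem_alignments {o : Outcome n} {σ : Equiv.Perm (Fin n)} :
    σ ∈ alignments o ↔ canonical n (clicks o) ∘ σ = o := by simp [alignments]

theorem prob_eq_canonical (lam : Prior n) (o : Outcome n) :
    lam.prob o = lam.prob (canonical n (clicks o)) := by
  obtain ⟨τ, hτ⟩ := alignments_nonempty o
  rw [← lam.symm τ (canonical n (clicks o)), mem_alignments.1 hτ]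

/-- The alignments of `o` are a translate, by any one of them, of the stabilizer of the canonical
profile. -/
theorem card_alignments (o : Outcome n) :
    #(alignments o) = #(alignments (canonical n (clicks o))) := by
  obtain ⟨τ, hτ⟩ := alignments_nonempty o
  have hτ := mem_alignments.1 hτ
  symm
  refine card_equiv (Equiv.mulRight τ) fun σ => ?_
  rw [mem_alignments, mem_alignments, clicks_canonical (Nat.le_of_lt_succ (clicks_lt o))]
  constructor
  · intro h
    rw [Equiv.coe_mulRight, Equiv.Perm.coe_mul, ← Function.comp_assoc, h, hτ]
  · intro h
    rw [Equiv.coe_mulRight, Equiv.Perm.coe_mul, ← Function.comp_assoc] at h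
    exact τ.surjective.injective_comp_right (h.trans hτ.symm)

/-- Each permutation `σ` aligns exactly one profile with `k` clicks, namely `canonical n k ∘ σ`. -/
theorem sum_alignments (k : ℕ) (hk : k ≤ n) (Φ : Equiv.Perm (Fin n) → ℝ) :
    ∑ o with clicks o = k, ∑ σ ∈ alignments o, Φ σ = ∑ σ, Φ σ := by
  refine Eq.trans ?_ (sum_fiberwise_of_maps_to (s := univ)
    (t := univ.filter fun o : Outcome n => clicks o = k)
    (g := fun σ : Equiv.Perm (Fin n) => canonical n k ∘ σ)
    (fun σ _ => by simp [clicks_comp, clicks_canonical hk]) Φ)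
  refine sum_congr rfl fun o ho => ?_
  rw [alignments, (mem_filter.1 ho).2]

/-- Averaging over the alignments of all outcome profiles with `k` clicks amounts to averaging over
all permutations. -/
theorem sum_prob_mul_alignments (lam : Prior n) {k : ℕ} (hk : k ≤ n)
    (Φ : Equiv.Perm (Fin n) → ℝ) :
    ∑ o with clicks o = k, lam.prob o * ((#(alignments o) : ℝ)⁻¹ * ∑ σ ∈ alignments o, Φ σ) =
      lam.level k * ((n.factorial : ℝ)⁻¹ * ∑ σ, Φ σ) := by
  -- By symmetry both factors are the same for all profiles with `k` clicks. Taking `Φ = 1` then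
  -- identifies `c`.
  set c := lam.prob (canonical n k) * (#(alignments (canonical n k)) : ℝ)⁻¹ with hc
  have key : ∀ Φ : Equiv.Perm (Fin n) → ℝ, ∑ o with clicks o = k, lam.prob o *
      ((#(alignments o) : ℝ)⁻¹ * ∑ σ ∈ alignments o, Φ σ) = c * ∑ σ, Φ σ := by
    intro Φ
    rw [← sum_alignments k hk, mul_sum]
    refine sum_congr rfl fun o ho => ?_
    rw [prob_eq_canonical lam o, card_alignments o, (mem_filter.1 ho).2, hc]
    ring
  have h1 : lam.level k = c * n.factorial := by
    have := key fun _ => 1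
    rw [sum_const, card_univ, Fintype.card_perm, Fintype.card_fin, nsmul_eq_mul, mul_one] at this
    rw [← this, Prior.level]
    refine sum_congr rfl fun o _ => ?_
    have : (#(alignments o) : ℝ) ≠ 0 := by exact_mod_cast (alignments_nonempty o).card_pos.ne'
    rw [sum_const, nsmul_eq_mul, mul_one, inv_mul_cancel₀ this, mul_one]
  have : (n.factorial : ℝ) ≠ 0 := by exact_mod_cast n.factorial_ne_zero
  rw [key, h1]
  field_simp

/-- A uniformly random permutation sends `i` to a uniformly random position: translation by a swap
shows that the sum does not depend on `i`. -/
theorem sum_perm_apply (i : Fin n) (F : Fin n → ℝ) :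
    (n : ℝ) * ∑ σ : Equiv.Perm (Fin n), F (σ i) = n.factorial * ∑ j, F j := by
  have h : ∀ j, ∑ σ : Equiv.Perm (Fin n), F (σ j) = ∑ σ : Equiv.Perm (Fin n), F (σ i) := by
    intro j
    refine Fintype.sum_equiv (Equiv.mulRight (Equiv.swap i j)) _ _ fun σ => ?_
    simp
  calc (n : ℝ) * ∑ σ : Equiv.Perm (Fin n), F (σ i)
      = ∑ j, ∑ σ : Equiv.Perm (Fin n), F (σ j) := by simp [h]
    _ = ∑ σ : Equiv.Perm (Fin n), ∑ j, F (σ j) := sum_comm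
    _ = ∑ σ : Equiv.Perm (Fin n), ∑ j, F j := sum_congr rfl fun σ _ => Equiv.sum_comp σ F
    _ = n.factorial * ∑ j, F j := by simp [Fintype.card_perm]

/-- The law of a bid profile permuted by a random alignment of `o`. -/
noncomputable def symmLaw (o : Outcome n) (b : Fin n → ℝ) : Measure (Fin n → ℝ) :=
  (#(alignments o) : ENNReal)⁻¹ • ∑ σ ∈ alignments o, Measure.dirac (b ∘ σ)

theorem card_alignments_ne_zero (o : Outcome n) : (#(alignments o) : ENNReal) ≠ 0 := by
  exact_mod_cast (alignments_nonempty o).card_pos.ne'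

instance (o : Outcome n) (b : Fin n → ℝ) : IsProbabilityMeasure (symmLaw o b) := by
  constructor
  simp [symmLaw, ENNReal.inv_mul_cancel (card_alignments_ne_zero o) (ENNReal.natCast_ne_top _)]

theorem ae_symmLaw {o : Outcome n} {b : Fin n → ℝ} {p : (Fin n → ℝ) → Prop}
    (h : ∀ σ : Equiv.Perm (Fin n), p (b ∘ σ)) : ∀ᵐ x ∂symmLaw o b, p x := by
  refine Measure.ae_smul_measure ?_ _
  rw [ae_finsetSum_measure_iff]
  intro σ _
  rw [ae_dirac_eq]
  exact h σ

theorem integrable_symmLaw (o : Outcome n) (b : Fin n → ℝ) (f : (Fin n → ℝ) → ℝ) :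
    Integrable f (symmLaw o b) := by
  refine Integrable.smul_measure ?_ (ENNReal.inv_ne_top.2 (card_alignments_ne_zero o))
  rw [integrable_finsetSum_measure]
  exact fun σ _ => integrable_dirac (by finiteness)

theorem integral_symmLaw (o : Outcome n) (b : Fin n → ℝ) (f : (Fin n → ℝ) → ℝ) :
    ∫ x, f x ∂symmLaw o b = (#(alignments o) : ℝ)⁻¹ * ∑ σ ∈ alignments o, f (b ∘ σ) := by
  rw [symmLaw, integral_smul_measure, integral_finsetSum_measure
    fun σ _ => integrable_dirac (by finiteness), smul_eq_mul, ENNReal.toReal_inv,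
    ENNReal.toReal_natCast]
  simp only [integral_dirac]

end Alignments

/-! ### The optimal signaling -/

section Optimal

/-- Two bids `h`, then `t` up to position `k`, then `z`. -/
def profile {α : Type*} (n k : ℕ) (h t z : α) : Fin n → α :=
  fun i => if i.val < 2 then h else if i.val < k then t else z

variable {n : ℕ}

theorem secmax_eq_of_top {x : Fin n → ℝ} {i j : Fin n} (hij : i ≠ j) (h : x i = x j)
    (hle : ∀ l, x l ≤ x i) : secmax x = x i := by
  have : Nonempty {p : Fin n × Fin n // p.1 ≠ p.2} := ⟨⟨(i, j), hij⟩⟩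
  refine le_antisymm (ciSup_le fun p => (min_le_left _ _).trans (hle _)) ?_
  exact (le_min le_rfl h.le).trans (le_ciSup (f := fun p : {p : Fin n × Fin n // p.1 ≠ p.2} =>
    min (x p.1.1) (x p.1.2)) (Set.finite_range _).bddAbove ⟨(i, j), hij⟩)

/-- The alternative `k ≤ 2` makes the middle block empty. It is needed after no click, when `h = t₀`
may lie below `t = t₁`. -/
theorem multiMaximal_profile (hn : 2 ≤ n) {k : ℕ} {h t : ℝ} (hh : 0 ≤ h) (ht : k ≤ 2 ∨ t ≤ h)
    (σ : Equiv.Perm (Fin n)) :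
    MultiMaximal (profile n k h t 0 ∘ σ) ∧ secmax (profile n k h t 0 ∘ σ) = h := by
  have hi : profile n k h t 0 (σ (σ.symm ⟨0, by omega⟩)) = h := by simp [profile]
  have hj : profile n k h t 0 (σ (σ.symm ⟨1, by omega⟩)) = h := by simp [profile]
  have hij : σ.symm ⟨0, by omega⟩ ≠ σ.symm (⟨1, by omega⟩ : Fin n) := by simp
  have hle : ∀ l, profile n k h t 0 (σ l) ≤ h := by
    intro l
    unfold profile
    split_ifs with h1 h2
    · exact le_rfl
    · exact ht.resolve_left (by omega)
    · exact hh
  refine ⟨⟨_, _, hij, hi.trans hj.symm, fun l => (hle l).trans_eq hi.symm⟩, ?_⟩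
  exact (secmax_eq_of_top hij (hi.trans hj.symm) fun l => (hle l).trans_eq hi.symm).trans hi

/-- A lottery between a bid profile that shows `t₁` to the surplus clickers, with probability `θ`,
and one that shows `t₀` to them. -/
noncomputable def lotteryLaw (θ t₀ t₁ : ℝ) (h : ℕ → ℝ) (o : Outcome n) : Measure (Fin n → ℝ) :=
  ENNReal.ofReal θ • symmLaw o (profile n (clicks o) (h (clicks o)) t₁ 0) +
    ENNReal.ofReal (1 - θ) • symmLaw o (profile n (clicks o) (h (clicks o)) t₀ 0)

variable {θ t₀ t₁ : ℝ} {h : ℕ → ℝ}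

theorem isProbabilityMeasure_lotteryLaw (h0 : 0 ≤ θ) (h1 : θ ≤ 1) (o : Outcome n) :
    IsProbabilityMeasure (lotteryLaw θ t₀ t₁ h o) := by
  constructor
  simp only [lotteryLaw, Measure.coe_add, Measure.coe_smul, Pi.add_apply, Pi.smul_apply,
    measure_univ, smul_eq_mul, mul_one]
  rw [← ENNReal.ofReal_add h0 (by linarith)]
  simp

theorem ae_lotteryLaw {o : Outcome n} {p : (Fin n → ℝ) → Prop}
    (hp : ∀ t, t = t₀ ∨ t = t₁ → ∀ σ : Equiv.Perm (Fin n),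
      p (profile n (clicks o) (h (clicks o)) t 0 ∘ σ)) :
    ∀ᵐ x ∂lotteryLaw θ t₀ t₁ h o, p x := by
  rw [lotteryLaw, ae_add_measure_iff]
  exact ⟨Measure.ae_smul_measure (ae_symmLaw (hp _ (.inr rfl))) _,
    Measure.ae_smul_measure (ae_symmLaw (hp _ (.inl rfl))) _⟩

theorem integral_lotteryLaw (h0 : 0 ≤ θ) (h1 : θ ≤ 1) (o : Outcome n) (f : (Fin n → ℝ) → ℝ) :
    ∫ x, f x ∂lotteryLaw θ t₀ t₁ h o = (#(alignments o) : ℝ)⁻¹ * ∑ σ ∈ alignments o,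
      (θ * f (profile n (clicks o) (h (clicks o)) t₁ 0 ∘ σ) +
        (1 - θ) * f (profile n (clicks o) (h (clicks o)) t₀ 0 ∘ σ)) := by
  rw [lotteryLaw, integral_add_measure
    ((integrable_symmLaw _ _ _).smul_measure ENNReal.ofReal_ne_top)
    ((integrable_symmLaw _ _ _).smul_measure ENNReal.ofReal_ne_top), integral_smul_measure,
    integral_smul_measure, integral_symmLaw, integral_symmLaw, ENNReal.toReal_ofReal h0,
    ENNReal.toReal_ofReal (by linarith), sum_add_distrib, ← mul_sum, ← mul_sum, smul_eq_mul,
    smul_eq_mul]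
  ring

theorem sum_click_block {k : ℕ} (hk : 2 ≤ k) (hkn : k ≤ n) (α β : ℝ) :
    ∑ j : Fin n, (if j.val < 2 then α else if j.val < k then β else 0) =
      2 * α + ((k : ℝ) - 2) * β := by
  obtain ⟨a, rfl⟩ := Nat.exists_eq_add_of_le hk
  obtain ⟨b, rfl⟩ := Nat.exists_eq_add_of_le hkn
  rw [Fin.sum_univ_eq_sum_range
    (fun j => if j < 2 then α else if j < 2 + a then β else 0) (2 + a + b),
    sum_range_add, sum_range_add]
  have e2 : ∀ j ∈ range a, (if 2 + j < 2 then α else if 2 + j < 2 + a then β else 0) = β :=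
    fun j hj => by
      have := mem_range.1 hj
      rw [if_neg (by omega), if_pos (by omega)]
  have e3 : ∀ j, (if 2 + a + j < 2 then α else if 2 + a + j < 2 + a then β else 0) = 0 :=
    fun j => by rw [if_neg (by omega), if_neg (by omega)]
  rw [sum_congr rfl e2]
  simp only [e3]
  simp [sum_range_succ]
  ring

/-- The aggregate miscalibration, weighted by `I`, of the bid profile used after `k` clicks. -/
noncomputable def blockSum (I : ℝ → ℝ) (h t : ℝ) (k : ℕ) : ℝ :=
  if 2 ≤ k then 2 * ((1 - h) * I h) + ((k : ℝ) - 2) * ((1 - t) * I t)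
  else if k = 1 then (1 - 2 * h) * I h else -(2 * h * I h)

/-- Non-clickers with bid `0` are calibrated pointwise, so only the top pair and the surplus
clickers count. -/
theorem sum_miscalibration_profile (hn : 2 ≤ n) {k : ℕ} (hk : k ≤ n) (I : ℝ → ℝ) (h t : ℝ) :
    ∑ j : Fin n, ((if canonical n k j = true then (1 : ℝ) else 0) - profile n k h t 0 j) *
      I (profile n k h t 0 j) = blockSum I h t k := by
  unfold blockSum
  split_ifs with h2 h1
  · rw [← sum_click_block h2 hk]
    refine sum_congr rfl fun j _ => ?_
    simp only [canonical, profile, decide_eq_true_eq]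
    split_ifs <;> first | omega | ring
  · subst h1
    obtain ⟨m, rfl⟩ := Nat.exists_eq_add_of_le' hn
    rw [Fin.sum_univ_succ, Fin.sum_univ_succ]
    simp [canonical, profile]
    ring
  · obtain rfl : k = 0 := by omega
    obtain ⟨m, rfl⟩ := Nat.exists_eq_add_of_le' hn
    rw [Fin.sum_univ_succ, Fin.sum_univ_succ]
    simp [canonical, profile]
    ring

/-- The aggregate miscalibration of the lottery, expressed through the levels of the prior. -/
theorem sum_miscalibration_lottery (lam : Prior n) (hn : 2 ≤ n) (h0 : 0 ≤ θ) (h1 : θ ≤ 1)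
    (I : ℝ → ℝ) (i : Fin n) :
    ∑ o, lam.prob o * ∫ x, ((if o i = true then (1 : ℝ) else 0) - x i) * I (x i)
        ∂lotteryLaw θ t₀ t₁ h o =
      (n : ℝ)⁻¹ * ∑ k ∈ range (n + 1), lam.level k *
        (θ * blockSum I (h k) t₁ k + (1 - θ) * blockSum I (h k) t₀ k) := by
  rw [← sum_fiberwise_of_maps_to (g := clicks) (t := range (n + 1))
    (fun o _ => mem_range.2 (clicks_lt o)), mul_sum]
  refine sum_congr rfl fun k hk => ?_
  have hk : k ≤ n := Nat.le_of_lt_succ (mem_range.1 hk)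
  set F : ℝ → Fin n → ℝ := fun t j =>
    ((if canonical n k j = true then (1 : ℝ) else 0) - profile n k (h k) t 0 j) *
      I (profile n k (h k) t 0 j) with hF
  have e := sum_prob_mul_alignments lam hk fun σ => θ * F t₁ (σ i) + (1 - θ) * F t₀ (σ i)
  have hn0 : (n : ℝ) ≠ 0 := by positivity
  have hf : (n.factorial : ℝ) ≠ 0 := by exact_mod_cast n.factorial_ne_zero
  have hsum : ∀ t, ∑ σ : Equiv.Perm (Fin n), F t (σ i) =
      (n : ℝ)⁻¹ * (n.factorial * blockSum I (h k) t k) := by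
    intro t
    rw [← sum_miscalibration_profile hn hk, ← sum_perm_apply i (F t), inv_mul_cancel_left₀ hn0]
  rw [sum_add_distrib, ← mul_sum, ← mul_sum, hsum, hsum] at e
  calc _ = _ := ?_
    _ = _ := e
    _ = _ := by field_simp
  refine sum_congr rfl fun o ho => ?_
  have hok := (mem_filter.1 ho).2
  rw [integral_lotteryLaw h0 h1]
  congr 2
  refine sum_congr rfl fun σ hσ => ?_
  -- Under an alignment the click of `i` and its bid are both read off at position `σ i`, so the
  -- integrand depends on `σ i` alone.
  have hoi : o i = canonical n k (σ i) := by
    rw [← congrFun (mem_alignments.1 hσ) i, hok]; rfl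
  simp only [hF, hoi, hok, Function.comp_apply]

end Optimal

/-! ### The lottery at the optimal thresholds: calibration, support and revenue -/

section Construction

variable {n : ℕ} (lam : Prior n)

/-- The probability with which the surplus clickers are pooled with the single-click bid. -/
noncomputable def poolProb (n : ℕ) (L : ℕ → ℝ) : ℝ := xStar n L / excess n L

theorem poolProb_mem {L : ℕ → ℝ} (h0 : 0 < L 0) (h1 : 0 < L 1) (hA : 0 < excess n L) :
    poolProb n L ∈ Set.Icc (0 : ℝ) 1 :=
  ⟨div_nonneg xStar_nonneg hA.le, div_le_one_of_le₀ (xStar_lt_excess h0 h1 hA).le hA.le⟩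

theorem target_pos {L : ℕ → ℝ} (h0 : 0 < L 0) (h1 : 0 < L 1) (hA : 0 < excess n L) (k : ℕ) :
    0 < target n L k := by
  unfold target
  split_ifs
  · exact one_pos
  · linarith [(tOne_mem_Ico (n := n) h1).1]
  · exact tZero_pos h0 h1 hA

theorem target_le_one {L : ℕ → ℝ} (h0 : 0 < L 0) (h1 : 0 < L 1) (hA : 0 < excess n L) (k : ℕ) :
    target n L k ≤ 1 := by
  have := (tOne_mem_Ico (n := n) h1).2
  unfold target
  split_ifs
  · exact le_rfl
  · exact this.le
  · exact (tZero_le_tOne h0 h1 hA).trans this.le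

variable {lam}

theorem pooled_mem {L : ℕ → ℝ} (h0 : 0 < L 0) (h1 : 0 < L 1) (hA : 0 < excess n L) {t : ℝ}
    (ht : t = tZero n L ∨ t = tOne n L) : t ∈ Set.Icc (0 : ℝ) 1 := by
  have := tOne_mem_Ico (n := n) h1
  have := tZero_pos h0 h1 hA
  have := tZero_le_tOne h0 h1 hA
  rcases ht with rfl | rfl <;> constructor <;> linarith [(tOne_mem_Ico (n := n) h1).1,
    (tOne_mem_Ico (n := n) h1).2]

theorem lottery_profile_top (hn : 2 ≤ n) {L : ℕ → ℝ} (h0 : 0 < L 0) (h1 : 0 < L 1)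
    (hA : 0 < excess n L) {t : ℝ} (ht : t = tZero n L ∨ t = tOne n L) (k : ℕ)
    (σ : Equiv.Perm (Fin n)) :
    MultiMaximal (profile n k (target n L k) t 0 ∘ σ) ∧
      secmax (profile n k (target n L k) t 0 ∘ σ) = target n L k := by
  refine multiMaximal_profile hn (target_pos h0 h1 hA k).le ?_ σ
  rcases le_or_gt k 2 with hk | hk
  · exact .inl hk
  · right
    rw [target, if_pos (by omega)]
    exact (pooled_mem h0 h1 hA ht).2

/-- The optimal signaling. -/
noncomputable def optimalSignaling (lam : Prior n) (h0 : 0 < lam.level 0) (h1 : 0 < lam.level 1)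
    (hA : 0 < excess n lam.level) : Signaling n where
  law := lotteryLaw (poolProb n lam.level) (tZero n lam.level) (tOne n lam.level)
    (target n lam.level)
  isProb := isProbabilityMeasure_lotteryLaw (poolProb_mem h0 h1 hA).1 (poolProb_mem h0 h1 hA).2
  mem_unit o := ae_lotteryLaw fun t ht σ i => by
    simp only [Function.comp_apply, profile]
    split_ifs
    · exact ⟨(target_pos h0 h1 hA _).le, target_le_one h0 h1 hA _⟩
    · exact pooled_mem h0 h1 hA ht
    · simp

variable (h0 : 0 < lam.level 0) (h1 : 0 < lam.level 1) (hA : 0 < excess n lam.level)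

/-- The bids `0` and `1` are always correct. The balance at `t₁` and at `t₀` is the equation
defining that threshold, with pooled mass `θ A = xStar` and `(1 - θ) A`. The test values at the two
bids stay arbitrary, so `t₀ = t₁` needs no separate treatment. -/
theorem calibrated_optimalSignaling (hn : 3 ≤ n) : Calibrated lam (optimalSignaling lam h0 h1 hA) := by
  refine calibrated_of_sum_integral_eq_zero fun i B _ => ?_
  have hθ := poolProb_mem h0 h1 hA
  refine (sum_miscalibration_lottery lam (by omega) hθ.1 hθ.2 _ i).trans ?_
  set L := lam.level with hL
  set I : ℝ → ℝ := B.indicator 1 with hI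
  set θ := poolProb n L with hθ'
  refine mul_eq_zero_of_right _ ?_
  rw [sum_range_eq_Icc (by omega)]
  have e : ∑ k ∈ Icc 2 n, L k * (θ * blockSum I (target n L k) (tOne n L) k +
      (1 - θ) * blockSum I (target n L k) (tZero n L) k) =
      excess n L * (θ * ((1 - tOne n L) * I (tOne n L)) +
        (1 - θ) * ((1 - tZero n L) * I (tZero n L))) := by
    rw [excess, sum_mul]
    refine sum_congr rfl fun k hk => ?_
    have hk := (mem_Icc.1 hk).1
    rw [blockSum, blockSum, if_pos hk, if_pos hk, target, if_pos hk]
    ring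
  have hX : θ * excess n L = xStar n L := div_mul_cancel₀ _ hA.ne'
  have e1 := tOne_mul (n := n) h1
  have e0 := tZero_mul h0 h1 hA
  rw [e]
  simp only [blockSum, target]
  norm_num
  linear_combination ((1 - tOne n L) * I (tOne n L) - (1 - tZero n L) * I (tZero n L)) * hX -
    I (tOne n L) * e1 - I (tZero n L) * e0

/-- The law is carried by finitely many profiles; a finite set is closed and therefore contains the
topological support. -/
theorem support_optimalSignaling (hn : 3 ≤ n) (o : Outcome n) :
    ∀ x ∈ ((optimalSignaling lam h0 h1 hA).law o).support, MultiMaximal x := by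
  set L := lam.level with hL
  set S : Set (Fin n → ℝ) := ⋃ σ : Equiv.Perm (Fin n),
    {profile n (clicks o) (target n L (clicks o)) (tZero n L) 0 ∘ σ,
      profile n (clicks o) (target n L (clicks o)) (tOne n L) 0 ∘ σ} with hS
  have hfin : S.Finite := Set.finite_iUnion fun σ => Set.toFinite _
  have hae : S ∈ ae ((optimalSignaling lam h0 h1 hA).law o) := by
    refine ae_lotteryLaw fun t ht σ => Set.mem_iUnion.2 ⟨σ, ?_⟩
    rcases ht with rfl | rfl <;> simp [hL]
  intro x hx
  obtain ⟨σ, hσ⟩ := Set.mem_iUnion.1 (Measure.support_subset_of_isClosed hfin.isClosed hae hx)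
  rcases hσ with rfl | rfl
  · exact (lottery_profile_top (by omega) h0 h1 hA (.inl rfl) _ σ).1
  · exact (lottery_profile_top (by omega) h0 h1 hA (.inr rfl) _ σ).1

theorem map_secmax_optimalSignaling (hn : 3 ≤ n) (o : Outcome n) :
    ((optimalSignaling lam h0 h1 hA).law o).map secmax =
      Measure.dirac (target n lam.level (clicks o)) := by
  have hae : secmax =ᵐ[(optimalSignaling lam h0 h1 hA).law o]
      fun _ => target n lam.level (clicks o) :=
    ae_lotteryLaw fun t ht σ => (lottery_profile_top (by omega) h0 h1 hA ht _ σ).2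
  rw [Measure.map_congr hae, Measure.map_const, measure_univ, one_smul]

theorem isOptimal_optimalSignaling (hn : 3 ≤ n) :
    IsOptimal lam (optimalSignaling lam h0 h1 hA) := by
  refine ⟨calibrated_optimalSignaling h0 h1 hA hn, fun π' hπ' => ?_⟩
  refine (revenue_le hn h0 h1 hA hπ').trans_eq ?_
  refine sum_congr rfl fun o _ => ?_
  rw [← integral_map (φ := secmax) (f := fun y => y) measurable_secmax.aemeasurable
    aestronglyMeasurable_id, map_secmax_optimalSignaling h0 h1 hA hn, integral_dirac]

end Construction

/-! ### Bit lengths -/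

theorem size_add_le (a b : ℕ) : (a + b).size ≤ max a.size b.size + 1 := by
  rw [Nat.size_le, pow_succ]
  have ha : a < 2 ^ max a.size b.size := Nat.size_le.1 (le_max_left _ _)
  have hb : b < 2 ^ max a.size b.size := Nat.size_le.1 (le_max_right _ _)
  omega

theorem size_mul_le (a b : ℕ) : (a * b).size ≤ a.size + b.size := by
  rw [Nat.size_le, pow_add]
  exact Nat.mul_lt_mul'' (Nat.lt_size_self a) (Nat.lt_size_self b)

theorem size_le_self (a : ℕ) : a.size ≤ a := Nat.size_le.2 Nat.lt_two_pow_self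

theorem bits_add_le (x y : ℤ) : bits (x + y) ≤ bits x + bits y := by
  have h1 := Nat.size_le_size (Int.natAbs_add_le x y)
  have h2 := size_add_le x.natAbs y.natAbs
  unfold bits
  omega

theorem bits_sub_le (x y : ℤ) : bits (x - y) ≤ bits x + bits y := by
  have h := bits_add_le x (-y)
  rwa [← sub_eq_add_neg, show bits (-y) = bits y by simp [bits]] at h

theorem bits_mul_le (x y : ℤ) : bits (x * y) ≤ bits x + bits y := by
  have h := size_mul_le x.natAbs y.natAbs
  rw [← Int.natAbs_mul] at h
  unfold bits
  omega

/-- Such a crude bound suffices for counters: they stay of order `n`, and the running time may be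
polynomial in `n` itself. -/
theorem bits_natCast_le {a b : ℕ} (h : a ≤ b) : bits (a : ℤ) ≤ b + 1 :=
  Nat.add_le_add_right (((Nat.size_le_size (by simpa using h)).trans (size_le_self b))) 1

/-! ### Arithmetic expressions and their compilation -/

/-- Integer expressions over registers and memory. -/
inductive Arith : Type
  | reg (r : ℕ)
  | const (c : ℤ)
  | mem (e : Arith)
  | add (a b : Arith)
  | sub (a b : Arith)
  | mul (a b : Arith)

namespace Arith

/-- The value in memory `m` with registers `v`. -/
def eval (m : ℤ → ℤ) (v : List ℤ) : Arith → ℤ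
  | reg r => v.getD r 0
  | const c => c
  | mem e => m (e.eval m v)
  | add a b => a.eval m v + b.eval m v
  | sub a b => a.eval m v - b.eval m v
  | mul a b => a.eval m v * b.eval m v

/-- All registers that occur are below `width`. -/
def width : Arith → ℕ
  | reg r => r + 1
  | const _ => 0
  | mem e => e.width
  | add a b => max a.width b.width
  | sub a b => max a.width b.width
  | mul a b => max a.width b.width

/-- Register `r` does not occur. -/
def avoids (r : ℕ) : Arith → Bool
  | reg q => q != r
  | const _ => true
  | mem e => e.avoids r
  | add a b => a.avoids r && b.avoids r
  | sub a b => a.avoids r && b.avoids r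
  | mul a b => a.avoids r && b.avoids r

/-- The bit length of the value is at most `weight` times that of the registers and the memory. -/
def weight : Arith → ℕ
  | reg _ => 1
  | const c => bits c
  | mem _ => 1
  | add a b => a.weight + b.weight
  | sub a b => a.weight + b.weight
  | mul a b => a.weight + b.weight

/-- The cost of the compiled program, in multiples of the square of the maximal bit length. -/
def cost : Arith → ℕ
  | reg _ => 3
  | const c => bits c
  | mem e => e.cost + e.weight + 1
  | add a b => a.cost + b.cost + a.weight + b.weight
  | sub a b => a.cost + b.cost + a.weight + b.weight
  | mul a b => a.cost + b.cost + a.weight * b.weight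

/-- Evaluate into register `d`, with the registers from `d` on as scratch space. -/
def compile : Arith → ℕ → Prog
  | reg r, d => .seq (.const d 0) (.add d r d)
  | const c, d => .const d c
  | mem e, d => .seq (e.compile d) (.load d d)
  | add a b, d => .seq (a.compile d) (.seq (b.compile (d + 1)) (.add d d (d + 1)))
  | sub a b, d => .seq (a.compile d) (.seq (b.compile (d + 1)) (.sub d d (d + 1)))
  | mul a b, d => .seq (a.compile d) (.seq (b.compile (d + 1)) (.mul d d (d + 1)))

theorem eval_set {r : ℕ} (m : ℤ → ℤ) (v : List ℤ) (x : ℤ) :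
    ∀ {e : Arith}, e.avoids r = true → e.eval m (v.set r x) = e.eval m v
  | reg q, h => by
    have h : q ≠ r := by simpa [avoids] using h
    simp [eval, h.symm]
  | const _, _ => rfl
  | mem e, h => by simp only [eval]; rw [eval_set (e := e) m v x h]
  | add a b, h => by
    have h : a.avoids r = true ∧ b.avoids r = true := by simpa [avoids] using h
    simp only [eval]; rw [eval_set m v x h.1, eval_set m v x h.2]
  | sub a b, h => by
    have h : a.avoids r = true ∧ b.avoids r = true := by simpa [avoids] using h
    simp only [eval]; rw [eval_set m v x h.1, eval_set m v x h.2]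
  | mul a b, h => by
    have h : a.avoids r = true ∧ b.avoids r = true := by simpa [avoids] using h
    simp only [eval]; rw [eval_set m v x h.1, eval_set m v x h.2]

/-- Registers and memory have bit length at most `B`. -/
structure Bounded (B : ℕ) (m : ℤ → ℤ) (v : List ℤ) : Prop where
  one_le : 1 ≤ B
  mem : ∀ a, bits (m a) ≤ B
  reg : ∀ x ∈ v, bits x ≤ B

variable {B : ℕ} {m : ℤ → ℤ} {v : List ℤ}

theorem Bounded.getD (h : Bounded B m v) (r : ℕ) : bits (v.getD r 0) ≤ B := by
  rw [List.getD_eq_getElem?_getD]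
  rcases hr : v[r]? with _ | x
  · exact h.one_le
  · exact h.reg x (List.mem_of_getElem? hr)

theorem Bounded.set (h : Bounded B m v) {x : ℤ} (hx : bits x ≤ B) (r : ℕ) :
    Bounded B m (v.set r x) :=
  ⟨h.one_le, h.mem, fun y hy => (List.mem_or_eq_of_mem_set hy).elim (h.reg y) fun e => e ▸ hx⟩

theorem bits_eval_le (h : Bounded B m v) : ∀ e : Arith, bits (e.eval m v) ≤ e.weight * B
  | reg r => by rw [weight, one_mul]; exact h.getD r
  | const c => Nat.le_mul_of_pos_right _ h.one_le
  | mem e => by rw [weight, one_mul]; exact h.mem _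
  | add a b => (bits_add_le _ _).trans
    ((add_le_add (bits_eval_le h a) (bits_eval_le h b)).trans_eq (add_mul _ _ _).symm)
  | sub a b => (bits_sub_le _ _).trans
    ((add_le_add (bits_eval_le h a) (bits_eval_le h b)).trans_eq (add_mul _ _ _).symm)
  | mul a b => (bits_mul_le _ _).trans
    ((add_le_add (bits_eval_le h a) (bits_eval_le h b)).trans_eq (add_mul _ _ _).symm)

/-- What `compile` achieves from a state that holds the registers `v`. -/
def Computes (B : ℕ) (m : ℤ → ℤ) (v : List ℤ) (e : Arith) (d : ℕ) (s : State) : Prop :=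
  ∃ s' T, Runs (e.compile d) s s' T ∧ T ≤ e.cost * B ^ 2 ∧ s'.reg d = e.eval m v ∧
    (∀ r < d, s'.reg r = s.reg r) ∧ s'.mem = s.mem ∧ s'.out = s.out

/-- Multiplication is charged quadratically, so linear costs are rounded up to let `B ^ 2` serve as
the common unit. -/
theorem le_sq_of_le {B x w : ℕ} (h : x ≤ w * B) : x ≤ w * B ^ 2 :=
  h.trans (Nat.mul_le_mul_left w (Nat.le_self_pow two_ne_zero B))

/-- Two operands are computed into `d` and `d + 1`. -/
theorem computes_operands {a b : Arith} {d : ℕ} {s : State}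
    (ha : Computes B m v a d s)
    (hb : ∀ s', (∀ r < d, s'.reg r = s.reg r) → s'.mem = s.mem → Computes B m v b (d + 1) s') :
    ∃ s₁ s₂ T₁ T₂, Runs (a.compile d) s s₁ T₁ ∧ Runs (b.compile (d + 1)) s₁ s₂ T₂ ∧
      T₁ + T₂ ≤ (a.cost + b.cost) * B ^ 2 ∧ s₂.reg d = a.eval m v ∧
      s₂.reg (d + 1) = b.eval m v ∧ (∀ r < d, s₂.reg r = s.reg r) ∧ s₂.mem = s.mem ∧
      s₂.out = s.out := by
  obtain ⟨s₁, T₁, r₁, c₁, e₁, k₁, m₁, o₁⟩ := ha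
  obtain ⟨s₂, T₂, r₂, c₂, e₂, k₂, m₂, o₂⟩ := hb s₁ k₁ m₁
  refine ⟨s₁, s₂, T₁, T₂, r₁, r₂, ?_, ?_, e₂, fun r hr => ?_, m₂.trans m₁, o₂.trans o₁⟩
  · rw [add_mul]; exact add_le_add c₁ c₂
  · rw [k₂ d (Nat.lt_succ_self d), e₁]
  · rw [k₂ r (by omega), k₁ r hr]

/-- The second operand is evaluated from register `d + 1` on, so the first result in `d` survives.
The registers of `v` lie below `d` and memory is never written, so both operands see the same data.
-/
theorem computes (h : Bounded B m v) : ∀ (e : Arith) (d : ℕ) (s : State), e.width ≤ v.length →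
    v.length ≤ d → (∀ r < v.length, s.reg r = v.getD r 0) → s.mem = m → Computes B m v e d s
  -- A copy is the addition of a scratch zero; it costs at most `1 + (B + 1) ≤ 3 B²`.
  | reg r, d, s, hw, hd, hs, hm => by
    have hr : r < v.length := hw
    have hrd : r ≠ d := by omega
    refine ⟨_, _, .seq (.const s d 0) (.add _ d r d), ?_, ?_, fun q hq => ?_, rfl, rfl⟩
    · have h1 := h.getD r
      have h2 : (s.setReg d 0).reg r = v.getD r 0 := by
        simp [State.setReg, hrd, hs r hr]
      have h3 : (s.setReg d 0).reg d = 0 := by simp [State.setReg]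
      rw [h2, h3]
      have h4 : bits 0 = 1 := rfl
      rw [h4, cost]
      nlinarith [h.one_le]
    · simp [State.setReg, eval, hrd, hs r hr]
    · simp [State.setReg, hq.ne]
  | const c, d, s, _, _, _, _ => by
    refine ⟨_, _, .const s d c, ?_, by simp [State.setReg, eval], fun q hq => ?_, rfl, rfl⟩
    · exact Nat.le_mul_of_pos_right _ (Nat.pow_pos h.one_le)
    · simp [State.setReg, hq.ne]
  | mem e, d, s, hw, hd, hs, hm => by
    obtain ⟨s₁, T₁, r₁, c₁, e₁, k₁, m₁, o₁⟩ := computes h e d s hw hd hs hm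
    refine ⟨_, _, .seq r₁ (.load s₁ d d), ?_, ?_, fun q hq => ?_, m₁, o₁⟩
    · rw [e₁, m₁, hm]
      have h1 := le_sq_of_le (bits_eval_le h e)
      have h2 := le_sq_of_le (w := 1) ((h.mem (e.eval m v)).trans_eq (one_mul B).symm)
      rw [cost, add_mul, add_mul]
      omega
    · simp [State.setReg, eval, e₁, m₁, hm]
    · rw [← k₁ q hq]; simp [State.setReg, hq.ne]
  | add a b, d, s, hw, hd, hs, hm => by
    obtain ⟨s₁, s₂, T₁, T₂, r₁, r₂, hc, ea, eb, k, hm', ho⟩ := computes_operands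
      (computes h a d s ((le_max_left _ _).trans hw) hd hs hm)
      (fun s' k' m' => computes h b (d + 1) s' ((le_max_right _ _).trans hw) (by omega)
        (fun r hr => (k' r (by omega)).trans (hs r hr)) (m'.trans hm))
    refine ⟨_, _, .seq r₁ (.seq r₂ (.add s₂ d d (d + 1))), ?_, ?_, fun q hq => ?_, hm', ho⟩
    · have h1 := le_sq_of_le (bits_eval_le h a)
      have h2 := le_sq_of_le (bits_eval_le h b)
      rw [ea, eb, cost, add_mul, add_mul _ a.weight]
      omega
    · simp [State.setReg, eval, ea, eb]
    · rw [← k q hq]; simp [State.setReg, hq.ne]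
  | sub a b, d, s, hw, hd, hs, hm => by
    obtain ⟨s₁, s₂, T₁, T₂, r₁, r₂, hc, ea, eb, k, hm', ho⟩ := computes_operands
      (computes h a d s ((le_max_left _ _).trans hw) hd hs hm)
      (fun s' k' m' => computes h b (d + 1) s' ((le_max_right _ _).trans hw) (by omega)
        (fun r hr => (k' r (by omega)).trans (hs r hr)) (m'.trans hm))
    refine ⟨_, _, .seq r₁ (.seq r₂ (.sub s₂ d d (d + 1))), ?_, ?_, fun q hq => ?_, hm', ho⟩
    · have h1 := le_sq_of_le (bits_eval_le h a)
      have h2 := le_sq_of_le (bits_eval_le h b)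
      rw [ea, eb, cost, add_mul, add_mul _ a.weight]
      omega
    · simp [State.setReg, eval, ea, eb]
    · rw [← k q hq]; simp [State.setReg, hq.ne]
  | mul a b, d, s, hw, hd, hs, hm => by
    obtain ⟨s₁, s₂, T₁, T₂, r₁, r₂, hc, ea, eb, k, hm', ho⟩ := computes_operands
      (computes h a d s ((le_max_left _ _).trans hw) hd hs hm)
      (fun s' k' m' => computes h b (d + 1) s' ((le_max_right _ _).trans hw) (by omega)
        (fun r hr => (k' r (by omega)).trans (hs r hr)) (m'.trans hm))
    refine ⟨_, _, .seq r₁ (.seq r₂ (.mul s₂ d d (d + 1))), ?_, ?_, fun q hq => ?_, hm', ho⟩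
    · have h1 := Nat.mul_le_mul (bits_eval_le h a) (bits_eval_le h b)
      have e : a.weight * B * (b.weight * B) = a.weight * b.weight * B ^ 2 := by ring
      rw [e] at h1
      rw [ea, eb, cost, add_mul]
      omega
    · simp [State.setReg, eval, ea, eb]
    · rw [← k q hq]; simp [State.setReg, hq.ne]

end Arith

/-! ### Structured programs over ten registers -/

/-- The state `s` holds the ten registers `v` and the memory `m`, all of bit length at most `B`. -/
structure Holds (B : ℕ) (m : ℤ → ℤ) (v : List ℤ) (s : State) : Prop where
  bounded : Arith.Bounded B m v
  length : v.length = 10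
  reg : ∀ r < 10, s.reg r = v.getD r 0
  mem : s.mem = m

/-- `P` turns the registers `v` into `v'` and appends `w` to the output, at cost `≤ C * B ^ 2`. -/
def Exec (B : ℕ) (m : ℤ → ℤ) (P : Prog) (v v' w : List ℤ) (C : ℕ) : Prop :=
  ∀ s, Holds B m v s → ∃ s' T, Runs P s s' T ∧ T ≤ C * B ^ 2 ∧ Holds B m v' s' ∧ s'.out = s.out ++ w

namespace Exec

variable {B : ℕ} {m : ℤ → ℤ}

theorem mono {P : Prog} {v v' w : List ℤ} {C C' : ℕ} (h : Exec B m P v v' w C) (hC : C ≤ C') :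
    Exec B m P v v' w C' := fun s hs => by
  obtain ⟨s', T, h1, h2, h3⟩ := h s hs
  exact ⟨s', T, h1, h2.trans (Nat.mul_le_mul_right _ hC), h3⟩

theorem seq {P Q : Prog} {v v' v'' w w' : List ℤ} {C C' : ℕ} (h : Exec B m P v v' w C)
    (h' : Exec B m Q v' v'' w' C') : Exec B m (.seq P Q) v v'' (w ++ w') (C + C') := fun s hs => by
  obtain ⟨s₁, T₁, r₁, c₁, k₁, o₁⟩ := h s hs
  obtain ⟨s₂, T₂, r₂, c₂, k₂, o₂⟩ := h' s₁ k₁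
  exact ⟨s₂, _, .seq r₁ r₂, by rw [add_mul]; omega, k₂, by rw [o₂, o₁, List.append_assoc]⟩

theorem ite {r : ℕ} {P Q : Prog} {v v' w : List ℤ} {C : ℕ} (hr : r < 10)
    (hP : 0 < v.getD r 0 → Exec B m P v v' w C) (hQ : v.getD r 0 ≤ 0 → Exec B m Q v v' w C) :
    Exec B m (.ite r P Q) v v' w (1 + C) := fun s hs => by
  have hb : bits (s.reg r) ≤ 1 * B ^ 2 := by
    rw [hs.reg r hr]
    exact Arith.le_sq_of_le ((hs.bounded.getD r).trans_eq (one_mul B).symm)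
  rcases lt_or_ge 0 (v.getD r 0) with h | h
  · obtain ⟨s', T, r', c', k', o'⟩ := hP h s hs
    exact ⟨s', _, .ite_pos (by rwa [hs.reg r hr]) r', by rw [add_mul]; omega, k', o'⟩
  · obtain ⟨s', T, r', c', k', o'⟩ := hQ h s hs
    exact ⟨s', _, .ite_neg (by rwa [hs.reg r hr]) r', by rw [add_mul]; omega, k', o'⟩

/-- A loop whose counter register `r` runs down from `N` to `0`. -/
theorem loop {r : ℕ} {P : Prog} {C : ℕ} (hr : r < 10) : ∀ (N : ℕ) (vs ws : ℕ → List ℤ),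
    (∀ i ≤ N, (vs i).getD r 0 = (N : ℤ) - i) →
    (∀ i < N, Exec B m P (vs i) (vs (i + 1)) (ws i) C) →
    Exec B m (.loop r P) (vs 0) (vs N) ((List.range N).flatMap ws) (N * (1 + C) + 1)
  | 0, vs, ws, hc, _ => fun s hs => by
    have h0 : s.reg r = 0 := by rw [hs.reg r hr, hc 0 le_rfl]; simp
    refine ⟨s, _, .loop_done h0.le, ?_, hs, by simp⟩
    rw [h0]
    have h1 : bits 0 = 1 := rfl
    exact Arith.le_sq_of_le (by rw [h1]; simpa using hs.bounded.one_le)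
  | N + 1, vs, ws, hc, hP => fun s hs => by
    have h0 : s.reg r = N + 1 := by rw [hs.reg r hr, hc 0 (Nat.zero_le _)]; simp
    have hb : bits (s.reg r) ≤ 1 * B ^ 2 := by
      rw [hs.reg r hr]
      exact Arith.le_sq_of_le ((hs.bounded.getD r).trans_eq (one_mul B).symm)
    obtain ⟨s₁, T₁, r₁, c₁, k₁, o₁⟩ := hP 0 (Nat.succ_pos N) s hs
    obtain ⟨s₂, T₂, r₂, c₂, k₂, o₂⟩ := loop hr N (fun i => vs (i + 1)) (fun i => ws (i + 1))
      (fun i hi => by rw [hc (i + 1) (by omega)]; push_cast; ring)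
      (fun i hi => hP (i + 1) (by omega)) s₁ k₁
    refine ⟨s₂, _, .loop_step (by omega) r₁ r₂, ?_, k₂, ?_⟩
    · have e : ((N + 1) * (1 + C) + 1) * B ^ 2 =
        1 * B ^ 2 + C * B ^ 2 + (N * (1 + C) + 1) * B ^ 2 := by ring
      omega
    · rw [o₂, o₁, List.append_assoc, List.range_succ_eq_map, List.flatMap_cons, List.flatMap_map]

end Exec

/-- `reg[r] := e` -/
def assign (r : ℕ) (e : Arith) : Prog :=
  .seq (e.compile 10) (.seq (.const 11 0) (.add r 10 11))

/-- Append the value of `e` to the output. -/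
def emit (e : Arith) : Prog := .seq (e.compile 10) (.print 10)

section Commands

variable {B : ℕ} {m : ℤ → ℤ} {v : List ℤ}

/-- The bound on the stored value is a hypothesis: deriving it from `weight` would multiply the bit
bound at each assignment, hence exponentially along a loop. -/
theorem exec_assign {r : ℕ} {e : Arith} (hr : r < 10) (hw : e.width ≤ 10)
    (hb : bits (e.eval m v) ≤ B) :
    Exec B m (assign r e) v (v.set r (e.eval m v)) [] (e.cost + 3) := fun s hs => by
  obtain ⟨s₁, T₁, r₁, c₁, e₁, k₁, m₁, o₁⟩ := Arith.computes hs.bounded e 10 s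
    (by rwa [hs.length]) hs.length.le (by rw [hs.length]; exact hs.reg) hs.mem
  refine ⟨_, _, .seq r₁ (.seq (.const s₁ 11 0) (.add _ r 10 11)), ?_,
    ⟨hs.bounded.set hb r, by simp [hs.length], fun q hq => ?_, m₁.trans hs.mem⟩, ?_⟩
  · have h1 : (s₁.setReg 11 0).reg 10 = e.eval m v := by simp [State.setReg, e₁]
    have h2 : (s₁.setReg 11 0).reg 11 = 0 := by simp [State.setReg]
    have h3 : bits 0 = 1 := rfl
    have h4 : 1 + (bits (e.eval m v) + 1) ≤ 3 * B ^ 2 := Arith.le_sq_of_le (by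
      have := hs.bounded.one_le
      omega)
    rw [h1, h2, h3, add_mul]
    omega
  · by_cases hqr : q = r
    · subst hqr
      simp [State.setReg, e₁, hs.length, hr]
    · have hk := k₁ q hq
      have hq' := hs.reg q hq
      simp [State.setReg, hqr, hk, hq', Ne.symm hqr, show q ≠ 11 by omega]
  · simp [State.setReg, o₁]

/-- A printed value stays in scratch space, so it may exceed `B` bits. -/
theorem exec_emit {e : Arith} (hw : e.width ≤ 10) :
    Exec B m (emit e) v v [e.eval m v] (e.cost + e.weight) := fun s hs => by
  obtain ⟨s₁, T₁, r₁, c₁, e₁, k₁, m₁, o₁⟩ := Arith.computes hs.bounded e 10 s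
    (by rwa [hs.length]) hs.length.le (by rw [hs.length]; exact hs.reg) hs.mem
  refine ⟨_, _, .seq r₁ (.print s₁ 10), ?_,
    ⟨hs.bounded, hs.length, fun q hq => (k₁ q hq).trans (hs.reg q hq), m₁.trans hs.mem⟩, ?_⟩
  · have := Arith.le_sq_of_le (Arith.bits_eval_le hs.bounded e)
    rw [e₁, add_mul]
    omega
  · rw [e₁, o₁]

/-- Three expressions, for the numbers `a`, `b`, `d` of `(a + b √2) / d`. -/
structure Triple where
  a : Arith
  b : Arith
  d : Arith

namespace Triple

def eval (m : ℤ → ℤ) (v : List ℤ) (t : Triple) : List ℤ :=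
  [t.a.eval m v, t.b.eval m v, t.d.eval m v]

def width (t : Triple) : ℕ := max t.a.width (max t.b.width t.d.width)

def avoids (r : ℕ) (t : Triple) : Bool := t.a.avoids r && t.b.avoids r && t.d.avoids r

def cost (t : Triple) : ℕ :=
  t.a.cost + t.a.weight + (t.b.cost + t.b.weight + (t.d.cost + t.d.weight))

def emit (t : Triple) : Prog :=
  .seq (CalibratedSignaling.emit t.a)
    (.seq (CalibratedSignaling.emit t.b) (CalibratedSignaling.emit t.d))

theorem exec_emit {t : Triple} (hw : t.width ≤ 10) :
    Exec B m t.emit v v (t.eval m v) t.cost :=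
  (CalibratedSignaling.exec_emit ((le_max_left _ _).trans hw)).seq
    ((CalibratedSignaling.exec_emit
      (((le_max_left _ _).trans (le_max_right _ _)).trans hw)).seq
      (CalibratedSignaling.exec_emit (((le_max_right _ _).trans (le_max_right _ _)).trans hw)))

theorem eval_set {r : ℕ} {t : Triple} (ht : t.avoids r = true) (x : ℤ) :
    t.eval m (v.set r x) = t.eval m v := by
  have h : (t.a.avoids r = true ∧ t.b.avoids r = true) ∧ t.d.avoids r = true := by
    simpa [avoids] using ht
  rw [eval, Arith.eval_set m v x h.1.1, Arith.eval_set m v x h.1.2, Arith.eval_set m v x h.2, eval]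

end Triple

/-- Emit `t` as many times as the value of `e`, with register `5` as counter. -/
def emitTimes (e : Arith) (t : Triple) : Prog :=
  .seq (assign 5 e) (.loop 5 (.seq t.emit (assign 5 (.sub (.reg 5) (.const 1)))))

/-- The counter starts and ends at zero, so the registers are restored and calls can be chained.
Since `t` does not read the counter, every round prints the same numbers. -/
theorem exec_emitTimes {e : Arith} {t : Triple} (he : e.width ≤ 10) (ht : t.width ≤ 10)
    (ht5 : t.avoids 5 = true) (hv : v.getD 5 0 = 0) {N M : ℕ} (hN : e.eval m v = N)
    (hNM : N ≤ M) (hM : M < B) :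
    Exec B m (emitTimes e t) v v (List.replicate N (t.eval m v)).flatten
      (e.cost + 4 + M * (t.cost + 14)) := fun s hs => by
  have hlen := hs.length
  have hbN : bits (e.eval m v) ≤ B := by
    rw [hN]; exact (bits_natCast_le hNM).trans hM
  have h1 := exec_assign (r := 5) (by norm_num) he hbN
  have h2 := Exec.loop (B := B) (m := m) (r := 5)
    (P := .seq t.emit (assign 5 (.sub (.reg 5) (.const 1)))) (C := t.cost + 13) (by norm_num) N
    (fun i => v.set 5 ((N : ℤ) - i)) (fun _ => t.eval m v)
    (fun i _ => by simp [hlen]) (fun i hi => by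
      have h3 := Triple.exec_emit (B := B) (m := m) (v := v.set 5 ((N : ℤ) - i)) ht
      have h5 : (Arith.sub (.reg 5) (.const 1)).eval m (v.set 5 ((N : ℤ) - i)) =
          (N : ℤ) - (i + 1 : ℕ) := by
        simp [Arith.eval, hlen]; ring
      have h4 := exec_assign (B := B) (m := m) (v := v.set 5 ((N : ℤ) - i)) (r := 5)
        (e := .sub (.reg 5) (.const 1)) (by norm_num) (by decide) (by
          rw [h5, show (N : ℤ) - (i + 1 : ℕ) = (N - (i + 1) : ℕ) by omega]
          exact (bits_natCast_le (b := M) (by omega)).trans hM)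
      rw [h5, List.set_set] at h4
      rw [Triple.eval_set ht5] at h3
      have h6 := h3.seq h4
      rw [List.append_nil] at h6
      exact h6.mono (by
        have : (Arith.sub (.reg 5) (.const 1)).cost + 3 = 11 := rfl
        omega))
  rw [hN] at h1
  simp only [Nat.cast_zero, sub_zero, sub_self] at h2
  have h3 := h1.seq h2
  have hv5 : v.set 5 0 = v := by
    refine List.ext_getElem? fun i => ?_
    rw [List.getElem?_set]
    split_ifs with h h' <;> [skip; omega; rfl]
    subst h
    have : v[5] = 0 := by simpa [hlen] using hv
    rw [List.getElem?_eq_getElem h', this]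
  rw [hv5] at h3
  have hw : [] ++ (List.range N).flatMap (fun _ => t.eval m v) =
      (List.replicate N (t.eval m v)).flatten := by
    rw [List.nil_append, List.flatMap_def]; simp [List.map_const']
  rw [hw] at h3
  refine (h3.mono ?_) s hs
  have := Nat.mul_le_mul_right (1 + (t.cost + 13)) hNM
  have e2 : M * (1 + (t.cost + 13)) = M * (t.cost + 14) := by ring
  omega

end Commands

/-! ### Printing a description -/

section Printing

/-- The constant `c`, as a triple. -/
def Triple.int (c : ℤ) : Triple := ⟨.const c, .const 0, .const 1⟩

/-- Emit one weighted bid profile: `h` twice, `p` times `t`, `q` times zero. -/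
def emitAtom (w h t : Triple) (p q : Arith) : Prog :=
  .seq w.emit (.seq h.emit (.seq h.emit (.seq (emitTimes p t) (emitTimes q (.int 0)))))

/-- The output of `emitAtom`. -/
def atomOut (w h t : List ℤ) (p q : ℕ) : List ℤ :=
  w ++ (h ++ (h ++ ((List.replicate p t).flatten ++ (List.replicate q [0, 0, 1]).flatten)))

/-- Emit a list of two weighted bid profiles. -/
def emitGroup (w w' h t t' : Triple) (p q : Arith) : Prog :=
  .seq (emit (.const 2)) (.seq (emitAtom w h t p q) (emitAtom w' h t' p q))

def groupOut (w w' h t t' : List ℤ) (p q : ℕ) : List ℤ :=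
  [2] ++ (atomOut w h t p q ++ atomOut w' h t' p q)

/-- Emit the lists for all click counts, given the weights `w`, `w'` and the bids `t₀`, `t₁`. -/
def emitAll (w w' t₀ t₁ : Triple) : Prog :=
  .seq (emitGroup w w' t₀ t₁ t₀ (.const 0) (.sub (.reg 0) (.const 2)))
    (.seq (emitGroup w w' t₁ t₁ t₀ (.const 0) (.sub (.reg 0) (.const 2)))
      (.seq (assign 3 (.const 2))
        (.seq (assign 4 (.sub (.reg 0) (.const 1)))
          (.loop 4 (.seq (emitGroup w w' (.int 1) t₁ t₀ (.sub (.reg 3) (.const 2))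
              (.sub (.reg 0) (.reg 3)))
            (.seq (assign 3 (.add (.reg 3) (.const 1)))
              (assign 4 (.sub (.reg 4) (.const 1)))))))))

def allOut (w w' t₀ t₁ : List ℤ) (n : ℕ) : List ℤ :=
  groupOut w w' t₀ t₁ t₀ 0 (n - 2) ++ (groupOut w w' t₁ t₁ t₀ 0 (n - 2) ++
    (List.range (n - 1)).flatMap fun i => groupOut w w' [1, 0, 1] t₁ t₀ i (n - (2 + i)))

/-- The triple can be printed: it reads registers below ten, but no counter. -/
def Triple.Printable (t : Triple) : Prop :=
  t.width ≤ 10 ∧ t.avoids 3 = true ∧ t.avoids 4 = true ∧ t.avoids 5 = true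

theorem Triple.printable_int (c : ℤ) : (Triple.int c).Printable :=
  ⟨Nat.zero_le _, rfl, rfl, rfl⟩

variable {B : ℕ} {m : ℤ → ℤ} {v : List ℤ}

theorem exec_emitAtom {w h t : Triple} {p q : Arith} (hw : w.Printable) (hh : h.Printable)
    (ht : t.Printable) (hp : p.width ≤ 10) (hq : q.width ≤ 10) (hv : v.getD 5 0 = 0)
    {N N' M : ℕ} (hN : p.eval m v = N) (hN' : q.eval m v = N') (hNM : N ≤ M) (hNM' : N' ≤ M)
    (hM : M < B) :
    Exec B m (emitAtom w h t p q) v v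
      (atomOut (w.eval m v) (h.eval m v) (t.eval m v) N N')
      (w.cost + 2 * h.cost + p.cost + q.cost + 8 + M * (t.cost + 36)) := by
  have h1 := Triple.exec_emit (B := B) (m := m) (v := v) hw.1
  have h2 := Triple.exec_emit (B := B) (m := m) (v := v) hh.1
  have h3 := exec_emitTimes hp ht.1 ht.2.2.2 hv hN hNM hM
  have h0 := Triple.printable_int 0
  have h4 := exec_emitTimes hq h0.1 h0.2.2.2 hv hN' hNM' hM
  refine (h1.seq (h2.seq (h2.seq (h3.seq h4)))).mono ?_
  have : (Triple.int 0).cost = 8 := rfl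
  rw [this]
  have e : M * (t.cost + 36) = M * (t.cost + 14) + M * (8 + 14) := by ring
  omega

/-- The bound on the cost of `emitGroup`. -/
def groupCost (w w' h t t' : Triple) (p q : Arith) (M : ℕ) : ℕ :=
  6 + (w.cost + 2 * h.cost + p.cost + q.cost + 8 + M * (t.cost + 36) +
    (w'.cost + 2 * h.cost + p.cost + q.cost + 8 + M * (t'.cost + 36)))

theorem exec_emitGroup {w w' h t t' : Triple} {p q : Arith} (hw : w.Printable)
    (hw' : w'.Printable) (hh : h.Printable) (ht : t.Printable) (ht' : t'.Printable)
    (hp : p.width ≤ 10) (hq : q.width ≤ 10) (hv : v.getD 5 0 = 0)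
    {N N' M : ℕ} (hN : p.eval m v = N) (hN' : q.eval m v = N') (hNM : N ≤ M) (hNM' : N' ≤ M)
    (hM : M < B) :
    Exec B m (emitGroup w w' h t t' p q) v v
      (groupOut (w.eval m v) (w'.eval m v) (h.eval m v) (t.eval m v) (t'.eval m v) N N')
      (groupCost w w' h t t' p q M) :=
  (exec_emit (e := .const 2) (Nat.zero_le _)).seq
    ((exec_emitAtom hw hh ht hp hq hv hN hN' hNM hNM' hM).seq
      (exec_emitAtom hw' hh ht' hp hq hv hN hN' hNM hNM' hM))

theorem Triple.eval_counters {t : Triple} (ht : t.Printable) (x y : ℤ) :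
    t.eval m ((v.set 3 x).set 4 y) = t.eval m v := by
  rw [Triple.eval_set ht.2.2.1, Triple.eval_set ht.2.1]

/-- The constant in the bound on the cost of `emitAll`. -/
def allCost (w w' t₀ t₁ : Triple) : ℕ :=
  100 + 10 * (w.cost + w'.cost + t₀.cost + t₁.cost)

theorem exec_emitAll {w w' t₀ t₁ : Triple} (hw : w.Printable) (hw' : w'.Printable)
    (h0 : t₀.Printable) (h1 : t₁.Printable) {n : ℕ} (hn : 2 ≤ n) (hB : n + 1 < B)
    (hlen : v.length = 10) (hvn : v.getD 0 0 = n) (hv5 : v.getD 5 0 = 0) :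
    ∃ v', Exec B m (emitAll w w' t₀ t₁) v v'
      (allOut (w.eval m v) (w'.eval m v) (t₀.eval m v) (t₁.eval m v) n)
      (allCost w w' t₀ t₁ * (n + 1) ^ 2) := by
  have hsub : (Arith.sub (.reg 0) (.const 2)).eval m v = (n - 2 : ℕ) := by
    rw [Arith.eval, Arith.eval, Arith.eval, hvn]; omega
  have g0 := exec_emitGroup hw hw' h0 h1 h0 (p := .const 0) (q := .sub (.reg 0) (.const 2))
    (Nat.zero_le _) (by decide) hv5 (m := m) (N := 0) rfl hsub (Nat.zero_le n) (by omega)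
    (by omega : n < B)
  have g1 := exec_emitGroup hw hw' h1 h1 h0 (p := .const 0) (q := .sub (.reg 0) (.const 2))
    (Nat.zero_le _) (by decide) hv5 (m := m) (N := 0) rfl hsub (Nat.zero_le n) (by omega)
    (by omega : n < B)
  have a3 := exec_assign (B := B) (m := m) (v := v) (r := 3) (e := .const 2) (by norm_num)
    (Nat.zero_le _) (by have : bits 2 = 3 := rfl
                        rw [Arith.eval, this]; omega)
  have e4 : (Arith.sub (.reg 0) (.const 1)).eval m (v.set 3 2) = (n : ℤ) - 1 := by
    simp only [Arith.eval]; rw [← hvn]; simp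
  have a4 := exec_assign (B := B) (m := m) (v := v.set 3 2) (r := 4)
    (e := .sub (.reg 0) (.const 1)) (by norm_num) (by decide) (by
      rw [e4, show (n : ℤ) - 1 = (n - 1 : ℕ) by omega]
      exact (bits_natCast_le (b := n) (by omega)).trans (by omega))
  rw [e4] at a4
  -- Register `3` holds the click count `2 + i`, register `4` the number of rounds left. Each of the
  -- `n - 1` rounds has cost linear in `n`, whence the factor `(n + 1) ^ 2`.
  set vs : ℕ → List ℤ := fun i => (v.set 3 (2 + i)).set 4 ((n : ℤ) - 1 - i) with hvs
  have hl := Exec.loop (B := B) (m := m) (r := 4) (P := .seq (emitGroup w w' (.int 1) t₁ t₀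
      (.sub (.reg 3) (.const 2)) (.sub (.reg 0) (.reg 3)))
      (.seq (assign 3 (.add (.reg 3) (.const 1))) (assign 4 (.sub (.reg 4) (.const 1)))))
    (C := groupCost w w' (.int 1) t₁ t₀ (.sub (.reg 3) (.const 2)) (.sub (.reg 0) (.reg 3)) n + 22)
    (by norm_num) (n - 1) vs
    (fun i => groupOut (w.eval m v) (w'.eval m v) [1, 0, 1] (t₁.eval m v) (t₀.eval m v) i
      (n - (2 + i)))
    (fun i _ => by simp [hvs, hlen]; omega)
    (fun i hi => by
      have b3 : (vs i).getD 3 0 = 2 + i := by simp [hvs, hlen]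
      have b4 : (vs i).getD 4 0 = (n : ℤ) - 1 - i := by simp [hvs, hlen]
      have b0 : (vs i).getD 0 0 = n := by rw [← hvn]; simp [hvs]
      have b5 : (vs i).getD 5 0 = 0 := by simpa [hvs] using hv5
      have g := exec_emitGroup (B := B) (m := m) (v := vs i) hw hw' (Triple.printable_int 1) h1 h0
        (p := .sub (.reg 3) (.const 2)) (q := .sub (.reg 0) (.reg 3)) (by decide) (by decide) b5
        (N := i) (N' := n - (2 + i)) (M := n)
        (by simp only [Arith.eval]; rw [b3]; omega)
        (by simp only [Arith.eval]; rw [b3, b0]; omega) (by omega) (by omega) (by omega)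
      rw [Triple.eval_counters hw, Triple.eval_counters hw', Triple.eval_counters h0,
        Triple.eval_counters h1] at g
      have e3 : (Arith.add (.reg 3) (.const 1)).eval m (vs i) = 2 + ((i + 1 : ℕ) : ℤ) := by
        simp only [Arith.eval]; rw [b3]; push_cast; ring
      have a3 := exec_assign (B := B) (m := m) (v := vs i) (r := 3)
        (e := .add (.reg 3) (.const 1)) (by norm_num) (by decide) (by
          rw [e3, show 2 + ((i + 1 : ℕ) : ℤ) = (2 + (i + 1) : ℕ) by push_cast; rfl]
          exact (bits_natCast_le (b := n + 1) (by omega)).trans (by omega))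
      rw [e3] at a3
      have e4 : (Arith.sub (.reg 4) (.const 1)).eval m ((vs i).set 3 (2 + ((i + 1 : ℕ) : ℤ))) =
          (n : ℤ) - 1 - (i + 1 : ℕ) := by
        simp [hvs, Arith.eval, hlen]; ring
      have a4 := exec_assign (B := B) (m := m) (v := (vs i).set 3 (2 + ((i + 1 : ℕ) : ℤ))) (r := 4)
        (e := .sub (.reg 4) (.const 1)) (by norm_num) (by decide) (by
          rw [e4, show (n : ℤ) - 1 - (i + 1 : ℕ) = (n - 1 - (i + 1) : ℕ) by omega]
          exact (bits_natCast_le (b := n) (by omega)).trans (by omega))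
      rw [e4] at a4
      have e : ((vs i).set 3 (2 + ((i + 1 : ℕ) : ℤ))).set 4 ((n : ℤ) - 1 - (i + 1 : ℕ)) =
          vs (i + 1) := by
        simp only [hvs]
        rw [List.set_comm _ _ (by norm_num : (4 : ℕ) ≠ 3), List.set_set, List.set_set]
      rw [e] at a4
      have := g.seq (a3.seq a4)
      rw [List.append_nil, List.append_nil] at this
      exact this)
  have hv0 : vs 0 = (v.set 3 2).set 4 ((n : ℤ) - 1) := by simp [hvs]
  rw [hv0] at hl
  refine ⟨vs (n - 1), ((g0.seq (g1.seq (a3.seq (a4.seq hl)))).mono ?_)⟩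
  obtain ⟨k, rfl⟩ := Nat.exists_eq_add_of_le hn
  have c1 : (Arith.const 0).cost = 1 := rfl
  have c2 : (Arith.sub (.reg 0) (.const 2)).cost = 10 := rfl
  have c3 : (Arith.sub (.reg 3) (.const 2)).cost = 10 := rfl
  have c4 : (Arith.sub (.reg 0) (.reg 3)).cost = 8 := rfl
  have c5 : (Arith.sub (.reg 0) (.const 1)).cost = 8 := rfl
  have c6 : (Arith.const 2).cost = 3 := rfl
  have c7 : (Triple.int 1).cost = 10 := rfl
  simp only [groupCost, allCost, c1, c2, c3, c4, c5, c6, c7]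
  rw [show 2 + k - 1 = k + 1 by omega]
  nlinarith [Nat.zero_le (k * k), Nat.zero_le (w.cost * k), Nat.zero_le (w'.cost * k),
    Nat.zero_le (t₀.cost * k), Nat.zero_le (t₁.cost * k), Nat.zero_le (w.cost * k * k),
    Nat.zero_le (w'.cost * k * k), Nat.zero_le (t₀.cost * k * k), Nat.zero_le (t₁.cost * k * k)]

end Printing

/-! ### The description that is printed -/

section Description

variable {n : ℕ}

/-- An integer, as an exact number. -/
def Num.int (c : ℤ) : Num := ⟨c, 0, 1, one_pos⟩

/-- The description of a lottery with weights `w`, `w'` and bids `t₀`, `t₁`. -/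
def lotteryDescription (n : ℕ) (w w' t₀ t₁ : Num) : Description n := fun k =>
  let h : Num := if 2 ≤ k.val then .int 1 else if k.val = 1 then t₁ else t₀
  [⟨w, profile n k h t₁ (.int 0)⟩, ⟨w', profile n k h t₀ (.int 0)⟩]

theorem ofFn_val_eq_map_range {α : Type*} (n : ℕ) (g : ℕ → α) :
    List.ofFn (fun i : Fin n => g i.val) = (List.range n).map g :=
  List.ext_getElem (by simp) fun i h h' => by simp

theorem map_range_eq_replicate {α : Type*} {n : ℕ} {g : ℕ → α} {c : α} (h : ∀ j < n, g j = c) :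
    (List.range n).map g = List.replicate n c :=
  List.eq_replicate_iff.2 ⟨by simp, fun x hx => by
    obtain ⟨j, hj, rfl⟩ := List.mem_map.1 hx
    exact h j (List.mem_range.1 hj)⟩

/-- The truncated `k - 2` and the `max k 2` reflect that the top pair takes two positions even when
`k < 2`. -/
theorem flatten_profile (hn : 2 ≤ n) {k : ℕ} (hk : k ≤ n) (h t z : Num) :
    (List.ofFn fun i => (profile n k h t z i).encode).flatten =
      h.encode ++ (h.encode ++ ((List.replicate (k - 2) t.encode).flatten ++
        (List.replicate (n - max k 2) z.encode).flatten)) := by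
  set g := fun j : ℕ => if j < 2 then h.encode else if j < k then t.encode else z.encode with hg
  have e : (fun i : Fin n => (profile n k h t z i).encode) = fun i : Fin n => g i.val := by
    funext i
    simp only [profile, hg]
    split_ifs <;> rfl
  have hsplit : n = 2 + (k - 2) + (n - max k 2) := by omega
  rw [e, ofFn_val_eq_map_range, hsplit, List.range_add, List.range_add, List.map_append,
    List.map_append, List.map_map, List.map_map,
    map_range_eq_replicate (c := h.encode) fun j hj => by simp only [hg]; rw [if_pos hj],
    map_range_eq_replicate (c := t.encode) fun j hj => by
      simp only [hg, Function.comp_apply]; rw [if_neg (by omega), if_pos (by omega)],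
    map_range_eq_replicate (c := z.encode) fun j hj => by
      simp only [hg, Function.comp_apply]; rw [if_neg (by omega), if_neg (by omega)],
    ← hsplit]
  simp [List.replicate_succ]

theorem encode_lotteryDescription (hn : 2 ≤ n) (w w' t₀ t₁ : Num) :
    (lotteryDescription n w w' t₀ t₁).encode =
      allOut w.encode w'.encode t₀.encode t₁.encode n := by
  set F : ℕ → List ℤ := fun k =>
    groupOut w.encode w'.encode (if 2 ≤ k then Num.int 1 else if k = 1 then t₁ else t₀).encode
      t₁.encode t₀.encode (k - 2) (n - max k 2) with hF
  have e : (fun k : Fin (n + 1) => ((lotteryDescription n w w' t₀ t₁ k).length : ℤ) ::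
      (lotteryDescription n w w' t₀ t₁ k).flatMap Atom.encode) = fun k => F k.val := by
    funext k
    simp only [lotteryDescription, hF, groupOut, atomOut, List.flatMap_cons, List.flatMap_nil,
      Atom.encode, flatten_profile hn (Nat.le_of_lt_succ k.isLt)]
    simp [Num.int, Num.encode]
  rw [Description.encode, e, ofFn_val_eq_map_range, show n + 1 = 2 + (n - 1) by omega,
    List.range_add, List.map_append, List.map_map, List.flatten_append, allOut, List.flatMap_def]
  have h0 : F 0 = groupOut w.encode w'.encode t₀.encode t₁.encode t₀.encode 0 (n - 2) := rfl
  have h1 : F 1 = groupOut w.encode w'.encode t₁.encode t₁.encode t₀.encode 0 (n - 2) := rfl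
  have h2 : ∀ i, F (2 + i) =
      groupOut w.encode w'.encode [1, 0, 1] t₁.encode t₀.encode i (n - (2 + i)) := by
    intro i
    simp only [hF]
    rw [if_pos (by omega), show 2 + i - 2 = i by omega, max_eq_left (by omega)]
    rfl
  rw [show List.range 2 = [0, 1] from rfl]
  simp [h0, h1, h2, Function.comp_def]

/-- A lottery description describes every signaling with the same law. -/
theorem describes_lotteryDescription {w w' t₀ t₁ : Num} {π : Signaling n} {h : ℕ → ℝ}
    (hw : 0 ≤ w.val) (hw' : w'.val = 1 - w.val) (hw1 : w.val ≤ 1)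
    (hh : ∀ k, h k = if 2 ≤ k then 1 else if k = 1 then t₁.val else t₀.val)
    (hπ : π.law = lotteryLaw w.val t₀.val t₁.val h) :
    (lotteryDescription n w w' t₀ t₁).Describes π := by
  constructor
  · intro k A hA
    simp only [lotteryDescription, List.mem_cons, List.not_mem_nil, or_false] at hA
    rcases hA with rfl | rfl
    · exact hw
    · change 0 ≤ w'.val
      linarith
  · intro o
    have hint : ∀ c, (Num.int c).val = c := fun c => by simp [Num.val, Num.int]
    have hval : ∀ (k : ℕ) (t : Num), (fun i => (profile n k
        (if 2 ≤ k then Num.int 1 else if k = 1 then t₁ else t₀) t (.int 0) i).val) =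
        profile n k (h k) t.val 0 := by
      intro k t
      funext i
      simp only [profile, hh]
      split_ifs <;> first | rfl | simp [hint]
    rw [hπ]
    simp only [lotteryLaw, Description.law, lotteryDescription, List.map_cons, List.map_nil,
      List.sum_cons, List.sum_nil, add_zero, hval, hw', symmLaw]

end Description

/-! ### Exact formulas for the thresholds -/

section Formulas

/-- The exact number `(a + b √2) / d`. -/
def Num.ofInt (a b d : ℤ) (h : 0 < d) : Num := ⟨a, b, d.toNat, by omega⟩

theorem Num.val_ofInt {a b d : ℤ} (h : 0 < d) : (Num.ofInt a b d h).val = (a + b * √2) / d := by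
  have : ((d.toNat : ℤ) : ℝ) = d := by rw [Int.toNat_of_nonneg h.le]
  rw [Num.val, ← this]
  rfl

theorem Num.encode_ofInt {a b d : ℤ} (h : 0 < d) : (Num.ofInt a b d h).encode = [a, b, d] := by
  simp [Num.encode, Num.ofInt, h.le]

variable {n : ℕ} {L : ℕ → ℝ} {u z a : ℤ} {M : ℝ}

/-- The sign test that tells the corner from the interior optimum is exact. -/
theorem interior_iff (hz : 0 < z) (ha : 0 < a) (hM : 0 < M) (hzL : (z : ℝ) = M * L 0)
    (haL : (a : ℝ) = M * excess n L) :
    0 < excess n L + 2 * L 0 * (1 - √2) ↔ 0 < (a + 2 * z) * (a + 2 * z) - 8 * (z * z) := by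
  have hz' : (0 : ℝ) < z := by exact_mod_cast hz
  have ha' : (0 : ℝ) < a := by exact_mod_cast ha
  have hs : 0 < √2 := by positivity
  have hss := sqrt_two_mul_self
  have e : M * (excess n L + 2 * L 0 * (1 - √2)) = a + 2 * z - 2 * √2 * z := by
    rw [hzL, haL]; ring
  -- The integer is the quantity in question times its conjugate, which is positive.
  have e2 : (((a + 2 * z) * (a + 2 * z) - 8 * (z * z) : ℤ) : ℝ) =
      (a + 2 * z - 2 * √2 * z) * (a + 2 * z + 2 * √2 * z) := by
    push_cast
    linear_combination (4 * z ^ 2 : ℝ) * hss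
  rw [← Int.cast_pos (R := ℝ), e2, ← mul_pos_iff_of_pos_left hM, e,
    mul_pos_iff_of_pos_right (by positivity)]

/-- By irrationality of `√2`, the denominator `u + z √2` can be rationalized. -/
theorem sq_sub_two_mul_sq_ne_zero (hz : 0 < z) : u * u - 2 * (z * z) ≠ 0 := by
  intro h
  have hz' : (0 : ℝ) < z := by exact_mod_cast hz
  have h' : ((u * u - 2 * (z * z) : ℤ) : ℝ) = 0 := by rw [h]; simp
  push_cast at h'
  refine irrational_sqrt_two ⟨|(u : ℚ) / z|, ?_⟩
  have e : ((u : ℝ) / z) ^ 2 = 2 := by field_simp; linarith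
  rw [← e, Real.sqrt_sq_eq_abs]
  push_cast
  rfl

/-- In both thresholds the factor `λ₁ + √2 λ₀` cancels, which leaves a rational denominator. The
pooling probability has to be rationalized by `w = u² - 2z²`, which may be negative; a further
factor `w` makes the denominator `w² a` positive. -/
theorem interior_formulas (hu : 0 < u) (hz : 0 < z) (ha : 0 < a) (hM : 0 < M)
    (hzL : (z : ℝ) = M * L 0) (huL : (u : ℝ) = M * L 1) (haL : (a : ℝ) = M * excess n L)
    (h : 0 < (a + 2 * z) * (a + 2 * z) - 8 * (z * z)) :
    tOne n L = (u + (a + 2 * z) + -z * √2) / (2 * u + (a + 2 * z)) ∧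
    tZero n L = (2 * u + a + -u * √2) / (2 * u + (a + 2 * z)) ∧
    poolProb n L = (u * (u * u - 2 * (z * z)) * (u * (a + 2 * z) + 4 * (z * z)) +
      -(u * (u * u - 2 * (z * z)) * (z * (a + 2 * z + 2 * u))) * √2) /
      ((u * u - 2 * (z * z)) * (u * u - 2 * (z * z)) * a) := by
  have hW : (u * u - 2 * (z * z) : ℝ) ≠ 0 := by
    exact_mod_cast sq_sub_two_mul_sq_ne_zero (u := u) hz
  have hz' : (0 : ℝ) < z := by exact_mod_cast hz
  have ha' : (0 : ℝ) < a := by exact_mod_cast ha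
  have hu' : (0 : ℝ) < u := by exact_mod_cast hu
  have h0 : 0 < L 0 := by rw [hzL] at hz'; exact (mul_pos_iff_of_pos_left hM).1 hz'
  have h1 : 0 < L 1 := by rw [huL] at hu'; exact (mul_pos_iff_of_pos_left hM).1 hu'
  have hA : 0 < excess n L := by rw [haL] at ha'; exact (mul_pos_iff_of_pos_left hM).1 ha'
  have hss := sqrt_two_mul_self
  have hX := xStar_nonneg (n := n) (L := L)
  have hXA := xStar_lt_excess h0 h1 hA
  have hx : xStar n L * (L 1 + √2 * L 0) = L 1 * (excess n L + 2 * L 0 * (1 - √2)) := by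
    rcases xStar_cases (n := n) h0 h1 with ⟨-, h'⟩ | ⟨-, h'⟩
    · exact absurd ((interior_iff hz ha hM hzL haL).2 h) h'.not_gt
    · exact h'
  refine ⟨?_, ?_, ?_⟩
  · rw [tOne, div_eq_div_iff (by positivity) (by positivity), huL, hzL, haL]
    linear_combination M * hx
  · rw [tZero, div_eq_div_iff (by linarith) (by positivity), huL, hzL, haL]
    linear_combination -M * √2 * hx + M * (L 0 * xStar n L + 2 * L 0 * L 1) * hss
  · have hxW : xStar n L * (L 1 * L 1 - 2 * (L 0 * L 0)) =
        L 1 * (L 1 * (excess n L + 2 * L 0) + 4 * (L 0 * L 0) -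
          L 0 * (excess n L + 2 * L 0 + 2 * L 1) * √2) := by
      linear_combination (L 1 - √2 * L 0) * hx +
        (xStar n L * L 0 ^ 2 + 2 * L 1 * L 0 ^ 2) * hss
    rw [poolProb, div_eq_div_iff hA.ne' (by positivity), huL, hzL, haL]
    linear_combination M ^ 5 * (L 1 * L 1 - 2 * (L 0 * L 0)) * excess n L * hxW

theorem corner_formulas (hu : 0 < u) (hz : 0 < z) (ha : 0 < a) (hM : 0 < M)
    (hzL : (z : ℝ) = M * L 0) (huL : (u : ℝ) = M * L 1) (haL : (a : ℝ) = M * excess n L)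
    (h : (a + 2 * z) * (a + 2 * z) - 8 * (z * z) ≤ 0) :
    tOne n L = 1 / 2 ∧ tZero n L = a / (2 * z + a) ∧ poolProb n L = 0 := by
  have hz' : (0 : ℝ) < z := by exact_mod_cast hz
  have ha' : (0 : ℝ) < a := by exact_mod_cast ha
  have hu' : (0 : ℝ) < u := by exact_mod_cast hu
  have h0 : 0 < L 0 := by rw [hzL] at hz'; exact (mul_pos_iff_of_pos_left hM).1 hz'
  have h1 : 0 < L 1 := by rw [huL] at hu'; exact (mul_pos_iff_of_pos_left hM).1 hu'
  have hx : xStar n L = 0 := by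
    rcases xStar_cases (n := n) h0 h1 with ⟨h', -⟩ | ⟨h', -⟩
    · exact h'
    · exact absurd ((interior_iff hz ha hM hzL haL).1 h') h.not_gt
  refine ⟨?_, ?_, by rw [poolProb, hx, zero_div]⟩
  · rw [tOne, hx]; field_simp; ring
  · have hA : 0 < excess n L := by rw [haL] at ha'; exact (mul_pos_iff_of_pos_left hM).1 ha'
    rw [tZero, hx, hzL, haL, div_eq_div_iff (by positivity) (by positivity)]; ring

end Formulas

/-! ### Reading the input -/

section Input

/-- Numerator and denominator of `∑ j < i, j * num (2 + j) / den (2 + j)`. -/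
def partialExcess (num den : ℕ → ℕ) : ℕ → ℕ × ℕ
  | 0 => (0, 1)
  | i + 1 => ((partialExcess num den i).1 * den (2 + i) +
      i * num (2 + i) * (partialExcess num den i).2, (partialExcess num den i).2 * den (2 + i))

variable {num den : ℕ → ℕ}

theorem partialExcess_snd_pos (h : ∀ k, 0 < den k) : ∀ i, 0 < (partialExcess num den i).2
  | 0 => one_pos
  | i + 1 => Nat.mul_pos (partialExcess_snd_pos h i) (h _)

theorem partialExcess_eq (h : ∀ k, 0 < den k) : ∀ i, ((partialExcess num den i).1 : ℝ) =
    (partialExcess num den i).2 * ∑ j ∈ range i, (j : ℝ) * (num (2 + j) / den (2 + j))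
  | 0 => by simp [partialExcess]
  | i + 1 => by
    have : (den (2 + i) : ℝ) ≠ 0 := by exact_mod_cast (h _).ne'
    rw [sum_range_succ, partialExcess]
    push_cast
    rw [partialExcess_eq h i]
    field_simp

/-- Without reduction to lowest terms the sizes still grow only additively. In the numerator, `n`
pays for the factor `i`, and the final `i` for one carry bit per addition. -/
theorem size_partialExcess {n : ℕ} (i : ℕ) (hi : i ≤ n) :
    (partialExcess num den i).1.size ≤
      ∑ j ∈ range i, max (num (2 + j)).size (den (2 + j)).size + 1 + n + i ∧
    (partialExcess num den i).2.size ≤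
      ∑ j ∈ range i, max (num (2 + j)).size (den (2 + j)).size + 1 := by
  induction i with
  | zero => simp [partialExcess]
  | succ i ih =>
    obtain ⟨h1, h2⟩ := ih (by omega)
    have a1 := size_mul_le (partialExcess num den i).1 (den (2 + i))
    have a2 := size_mul_le (i * num (2 + i)) (partialExcess num den i).2
    have a3 := size_mul_le i (num (2 + i))
    have a4 := size_mul_le (partialExcess num den i).2 (den (2 + i))
    have a5 := size_add_le ((partialExcess num den i).1 * den (2 + i))
      (i * num (2 + i) * (partialExcess num den i).2)
    have a6 := size_le_self i
    have a7 := le_max_left (num (2 + i)).size (den (2 + i)).size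
    have a8 := le_max_right (num (2 + i)).size (den (2 + i)).size
    rw [sum_range_succ, partialExcess]
    dsimp only
    constructor <;> omega

theorem getD_flatMap_pair (f g : ℕ → ℤ) : ∀ (l : List ℕ) (i : ℕ) (hi : i < l.length),
    (l.flatMap fun k => [f k, g k]).getD (2 * i) 0 = f l[i] ∧
      (l.flatMap fun k => [f k, g k]).getD (2 * i + 1) 0 = g l[i]
  | _ :: _, 0, _ => by simp
  | a :: l, i + 1, hi => by
    obtain ⟨h1, h2⟩ := getD_flatMap_pair f g l i (by simpa using hi)
    rw [show 2 * (i + 1) = 2 * i + 1 + 1 by ring]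
    simpa using ⟨h1, h2⟩

/-- The memory `m` holds the number of bidders and the fractions `num k / den k`. -/
structure HoldsInput (m : ℤ → ℤ) (n : ℕ) (num den : ℕ → ℕ) : Prop where
  bidders : m 0 = n
  num : ∀ k ≤ n, m (2 * k + 1) = num k
  den : ∀ k ≤ n, m (2 * k + 2) = den k

variable {n : ℕ}

theorem inputList_eq (num den : ℕ → ℕ) :
    inputList n (fun k => num k) (fun k => den k) =
      (n : ℤ) :: (List.range (n + 1)).flatMap fun k => [(num k : ℤ), (den k : ℤ)] := by
  rw [inputList, List.flatMap_def, ← ofFn_val_eq_map_range]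

theorem initState_mem (l : List ℤ) (a : ℤ) :
    (initState l).mem a = if 0 ≤ a then l.getD a.toNat 0 else 0 := rfl

theorem holdsInput_initState (num den : ℕ → ℕ) :
    HoldsInput (initState (inputList n (fun k => num k) (fun k => den k))).mem n num den := by
  rw [inputList_eq]
  have key := fun k (hk : k ≤ n) => getD_flatMap_pair (fun k => (num k : ℤ)) (fun k => (den k : ℤ))
    (List.range (n + 1)) k (by simpa using Nat.lt_succ_of_le hk)
  refine ⟨by simp [initState], fun k hk => ?_, fun k hk => ?_⟩
  · have e : (2 * (k : ℤ) + 1).toNat = 2 * k + 1 := by omega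
    rw [initState_mem, if_pos (by omega), e, List.getD_cons_succ, (key k hk).1, List.getElem_range]
  · have e : (2 * (k : ℤ) + 2).toNat = 2 * k + 1 + 1 := by omega
    rw [initState_mem, if_pos (by omega), e, List.getD_cons_succ, (key k hk).2, List.getElem_range]

theorem size_le_inputSize (num den : ℕ → ℕ) {k : ℕ} (hk : k ≤ n) :
    max (num k).size (den k).size + n ≤ inputSize n (fun k => num k) (fun k => den k) := by
  rw [inputSize, add_comm]
  have := single_le_sum (f := fun k : Fin (n + 1) => max (num k).size (den k).size)
    (fun _ _ => Nat.zero_le _) (mem_univ ⟨k, Nat.lt_succ_of_le hk⟩)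
  exact Nat.add_le_add_left this n

theorem sum_size_le_inputSize (num den : ℕ → ℕ) {i : ℕ} (hi : i + 1 ≤ n) :
    ∑ j ∈ range i, max (num (2 + j)).size (den (2 + j)).size + n ≤
      inputSize n (fun k => num k) (fun k => den k) := by
  rw [inputSize, add_comm, Fin.sum_univ_eq_sum_range (fun k => max (num k).size (den k).size)]
  refine Nat.add_le_add_left ?_ n
  calc _ ≤ ∑ j ∈ range (2 + i), max (num j).size (den j).size := by
        rw [sum_range_add]; exact Nat.le_add_left _ _
    _ ≤ _ := sum_le_sum_of_subset (range_mono (by omega))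

theorem bits_initState_le (num den : ℕ → ℕ) (a : ℤ) :
    bits ((initState (inputList n (fun k => num k) (fun k => den k))).mem a) ≤
      inputSize n (fun k => num k) (fun k => den k) + 1 := by
  have h0 : bits 0 ≤ inputSize n (fun k => num k) (fun k => den k) + 1 := Nat.le_add_left _ _
  rw [initState_mem]
  split_ifs with ha
  · rw [List.getD_eq_getElem?_getD]
    rcases hx : (inputList n (fun k => num k) (fun k => den k))[a.toNat]? with _ | x
    · exact h0
    · have hmem := List.mem_of_getElem? hx
      rw [inputList_eq, List.mem_cons, List.mem_flatMap] at hmem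
      rw [Option.getD_some]
      rcases hmem with rfl | ⟨k, hk, hx⟩
      · exact (bits_natCast_le le_rfl).trans (Nat.succ_le_succ (Nat.le_add_right _ _))
      · have := size_le_inputSize (n := n) num den (Nat.le_of_lt_succ (List.mem_range.1 hk))
        rcases List.mem_cons.1 hx with rfl | hx
        · simp only [bits, Int.natAbs_natCast]; omega
        · obtain rfl := List.mem_singleton.1 hx
          simp only [bits, Int.natAbs_natCast]; omega
  · exact h0

end Input

/-! ### The program -/

section Program

/-- The numerator of `λ_k`, for `k` in register `3`. -/
def numCell : Arith := .mem (.add (.mul (.const 2) (.reg 3)) (.const 1))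

/-- The denominator of `λ_k`, for `k` in register `3`. -/
def denCell : Arith := .mem (.add (.mul (.const 2) (.reg 3)) (.const 2))

/-- Compute `partialExcess` in the registers `1` and `2`. -/
def accumulate : Prog :=
  .seq (assign 0 (.mem (.const 0)))
    (.seq (assign 2 (.const 1))
      (.seq (assign 3 (.const 2))
        (.seq (assign 4 (.sub (.reg 0) (.const 1)))
          (.loop 4
            (.seq (assign 1 (.add (.mul (.reg 1) denCell)
                (.mul (.mul (.sub (.reg 3) (.const 2)) numCell) (.reg 2))))
              (.seq (assign 2 (.mul (.reg 2) denCell))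
                (.seq (assign 3 (.add (.reg 3) (.const 1)))
                  (assign 4 (.sub (.reg 4) (.const 1))))))))))

/-- `a + 2 z` -/
def shiftExpr : Arith := .add (.reg 8) (.mul (.const 2) (.reg 7))

/-- `u² - 2 z²` -/
def discExpr : Arith :=
  .sub (.mul (.reg 6) (.reg 6)) (.mul (.const 2) (.mul (.reg 7) (.reg 7)))

/-- The sign test for an interior optimum. -/
def testExpr : Arith :=
  .sub (.mul shiftExpr shiftExpr) (.mul (.const 8) (.mul (.reg 7) (.reg 7)))

def poolRat : Arith :=
  .mul (.mul (.reg 6) discExpr)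
    (.add (.mul (.reg 6) shiftExpr) (.mul (.const 4) (.mul (.reg 7) (.reg 7))))

def poolIrr : Arith :=
  .mul (.mul (.reg 6) discExpr)
    (.mul (.reg 7) (.add shiftExpr (.mul (.const 2) (.reg 6))))

def poolDen : Arith := .mul (.mul discExpr discExpr) (.reg 8)

def bidDen : Arith := .add (.mul (.const 2) (.reg 6)) shiftExpr

/-- Print the description for an interior optimum. -/
def emitInterior : Prog :=
  emitAll ⟨poolRat, .sub (.const 0) poolIrr, poolDen⟩
    ⟨.sub poolDen poolRat, poolIrr, poolDen⟩
    ⟨.add (.mul (.const 2) (.reg 6)) (.reg 8), .sub (.const 0) (.reg 6), bidDen⟩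
    ⟨.add (.reg 6) shiftExpr, .sub (.const 0) (.reg 7), bidDen⟩

/-- Print the description for a corner optimum. -/
def emitCorner : Prog :=
  emitAll (.int 0) (.int 1)
    ⟨.reg 8, .const 0, .add (.mul (.const 2) (.reg 7)) (.reg 8)⟩ ⟨.const 1, .const 0, .const 2⟩

/-- Compute the optimal signaling from the levels of the prior. -/
def mainProg : Prog :=
  .seq accumulate
    (.seq (assign 6 (.mul (.mul (.mem (.const 3)) (.mem (.const 2))) (.reg 2)))
      (.seq (assign 7 (.mul (.mul (.mem (.const 1)) (.mem (.const 4))) (.reg 2)))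
        (.seq (assign 8 (.mul (.mul (.mem (.const 2)) (.mem (.const 4))) (.reg 1)))
          (.seq (assign 9 testExpr) (.ite 9 emitInterior emitCorner)))))

variable {B : ℕ} {m : ℤ → ℤ} {n : ℕ} {num den : ℕ → ℕ}

/-- `exec_assign`, with the value and the new registers in a prescribed form. -/
theorem exec_assign_of_eq {v v' : List ℤ} {r : ℕ} {e : Arith} {x : ℤ} {C : ℕ} (hr : r < 10)
    (hw : e.width ≤ 10) (hx : e.eval m v = x) (hb : bits x ≤ B) (hv : v.set r x = v')
    (hC : e.cost + 3 ≤ C) : Exec B m (assign r e) v v' [] C := by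
  subst hx hv
  exact (exec_assign hr hw hb).mono hC

/-- The registers after `i` rounds of the accumulating loop. -/
def accRegs (n : ℕ) (num den : ℕ → ℕ) (i : ℕ) : List ℤ :=
  [n, (partialExcess num den i).1, (partialExcess num den i).2, 2 + i, n - 1 - i, 0, 0, 0, 0, 0]

theorem exec_accumulate (hin : HoldsInput m n num den) (hn : 2 ≤ n) (hnB : n + 2 ≤ B)
    (hS : ∀ i < n, bits (partialExcess num den i).1 ≤ B)
    (hQ : ∀ i < n, bits (partialExcess num den i).2 ≤ B) :
    Exec B m accumulate (List.replicate 10 0) (accRegs n num den (n - 1)) []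
      (200 * (n + 1)) := by
  have a0 : Exec B m (assign 0 (.mem (.const 0))) (List.replicate 10 0)
      [n, 0, 0, 0, 0, 0, 0, 0, 0, 0] [] 6 :=
    exec_assign_of_eq (by norm_num) (by decide) hin.bidders
      ((bits_natCast_le le_rfl).trans (by omega)) rfl (by decide)
  have a2 : Exec B m (assign 2 (.const 1)) [n, 0, 0, 0, 0, 0, 0, 0, 0, 0]
      [n, 0, 1, 0, 0, 0, 0, 0, 0, 0] [] 5 :=
    exec_assign_of_eq (x := 1) (by norm_num) (by decide) rfl
      (by have : bits 1 = 2 := rfl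
          omega) rfl (by decide)
  have a3 : Exec B m (assign 3 (.const 2)) [n, 0, 1, 0, 0, 0, 0, 0, 0, 0]
      [n, 0, 1, 2, 0, 0, 0, 0, 0, 0] [] 6 :=
    exec_assign_of_eq (x := 2) (by norm_num) (by decide) rfl
      (by have : bits 2 = 3 := rfl
          omega) rfl (by decide)
  have hcount : ∀ i : ℕ, i < n → bits ((n : ℤ) - 1 - i) ≤ B := fun i hi => by
    rw [show (n : ℤ) - 1 - i = (n - 1 - i : ℕ) by omega]
    exact (bits_natCast_le (b := n) (by omega)).trans (by omega)
  have a4 : Exec B m (assign 4 (.sub (.reg 0) (.const 1))) [n, 0, 1, 2, 0, 0, 0, 0, 0, 0]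
      (accRegs n num den 0) [] 11 :=
    exec_assign_of_eq (x := (n : ℤ) - 1) (by norm_num) (by decide) rfl
      (by simpa using hcount 0 (by omega)) (by simp [accRegs, partialExcess]) (by decide)
  have hl := Exec.loop (B := B) (m := m) (r := 4)
    (P := .seq (assign 1 (.add (.mul (.reg 1) denCell)
                (.mul (.mul (.sub (.reg 3) (.const 2)) numCell) (.reg 2))))
              (.seq (assign 2 (.mul (.reg 2) denCell))
                (.seq (assign 3 (.add (.reg 3) (.const 1)))
                  (assign 4 (.sub (.reg 4) (.const 1))))))
    (C := 170) (by norm_num) (n - 1) (accRegs n num den) (fun _ => [])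
    (fun i _ => by simp [accRegs]; omega)
    (fun i hi => by
      set S := (partialExcess num den i).1 with hSi
      set Q := (partialExcess num den i).2 with hQi
      set S' := (partialExcess num den (i + 1)).1 with hSi'
      set Q' := (partialExcess num den (i + 1)).2 with hQi'
      have eS : (S' : ℤ) = S * den (2 + i) + i * num (2 + i) * Q := by
        rw [hSi', hSi, hQi, partialExcess]; push_cast; ring
      have eQ : (Q' : ℤ) = Q * den (2 + i) := by
        rw [hQi', hQi, partialExcess]; push_cast; ring
      have hd : ∀ x y : ℤ, denCell.eval m [n, x, y, 2 + i, n - 1 - i, 0, 0, 0, 0, 0] =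
          den (2 + i) := fun x y => by
        rw [← hin.den (2 + i) (by omega)]; push_cast; rfl
      have hnm : ∀ x y : ℤ, numCell.eval m [n, x, y, 2 + i, n - 1 - i, 0, 0, 0, 0, 0] =
          num (2 + i) := fun x y => by
        rw [← hin.num (2 + i) (by omega)]; push_cast; rfl
      have b1 : Exec B m (assign 1 (.add (.mul (.reg 1) denCell)
            (.mul (.mul (.sub (.reg 3) (.const 2)) numCell) (.reg 2))))
          (accRegs n num den i) [n, S', Q, 2 + i, n - 1 - i, 0, 0, 0, 0, 0] [] 110 := by
        refine exec_assign_of_eq (x := S') (by norm_num) (by decide) ?_ (hS _ (by omega)) rfl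
          (by decide)
        simp only [Arith.eval, accRegs]
        rw [hd, hnm, eS]
        simp [hSi, hQi]
      have b2 : Exec B m (assign 2 (.mul (.reg 2) denCell))
          [n, S', Q, 2 + i, n - 1 - i, 0, 0, 0, 0, 0]
          [n, S', Q', 2 + i, n - 1 - i, 0, 0, 0, 0, 0] [] 35 := by
        refine exec_assign_of_eq (x := Q') (by norm_num) (by decide) ?_ (hQ _ (by omega)) rfl
          (by decide)
        simp only [Arith.eval]
        rw [hd, eQ]
        simp
      have b3 : Exec B m (assign 3 (.add (.reg 3) (.const 1)))
          [n, S', Q', 2 + i, n - 1 - i, 0, 0, 0, 0, 0]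
          [n, S', Q', 2 + (i + 1 : ℕ), n - 1 - i, 0, 0, 0, 0, 0] [] 11 := by
        refine exec_assign_of_eq (x := 2 + ((i + 1 : ℕ) : ℤ)) (by norm_num) (by decide) ?_ ?_ rfl
          (by decide)
        · simp [Arith.eval]; ring
        · rw [show 2 + ((i + 1 : ℕ) : ℤ) = (2 + (i + 1) : ℕ) by push_cast; rfl]
          exact (bits_natCast_le (b := n + 1) (by omega)).trans (by omega)
      have b4 : Exec B m (assign 4 (.sub (.reg 4) (.const 1)))
          [n, S', Q', 2 + (i + 1 : ℕ), n - 1 - i, 0, 0, 0, 0, 0]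
          (accRegs n num den (i + 1)) [] 11 := by
        refine exec_assign_of_eq (x := n - 1 - (i + 1 : ℕ)) (by norm_num) (by decide) ?_
          (hcount _ (by omega)) rfl (by decide)
        simp [Arith.eval]; ring
      exact (b1.seq (b2.seq (b3.seq b4))).mono (by norm_num))
  have h := a0.seq (a2.seq (a3.seq (a4.seq hl)))
  have e : ∀ l : List ℕ, (l.flatMap fun _ => ([] : List ℤ)) = [] := fun l => by simp
  rw [e] at h
  exact h.mono (by omega)

/-- The registers when printing starts. -/
def finalRegs (n : ℕ) (S Q k c u z a f : ℤ) : List ℤ := [n, S, Q, k, c, 0, u, z, a, f]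

/-- The constant in the bound on the cost of the program. -/
def progCost : ℕ :=
  500 + allCost ⟨poolRat, .sub (.const 0) poolIrr, poolDen⟩ ⟨.sub poolDen poolRat, poolIrr, poolDen⟩
    ⟨.add (.mul (.const 2) (.reg 6)) (.reg 8), .sub (.const 0) (.reg 6), bidDen⟩
    ⟨.add (.reg 6) shiftExpr, .sub (.const 0) (.reg 7), bidDen⟩ +
  allCost (.int 0) (.int 1)
    ⟨.reg 8, .const 0, .add (.mul (.const 2) (.reg 7)) (.reg 8)⟩ ⟨.const 1, .const 0, .const 2⟩

/-- The four exact numbers that make up the description printed for the integers `u`, `z`, `a`. -/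
def solution (u z a : ℤ) : List (List ℤ) :=
  let g := a + 2 * z
  let w := u * u - 2 * (z * z)
  if 0 < g * g - 8 * (z * z) then
    [[u * w * (u * g + 4 * (z * z)), 0 - u * w * (z * (g + 2 * u)), w * w * a],
      [w * w * a - u * w * (u * g + 4 * (z * z)), u * w * (z * (g + 2 * u)), w * w * a],
      [2 * u + a, 0 - u, 2 * u + g], [u + g, 0 - z, 2 * u + g]]
  else [[0, 0, 1], [1, 0, 1], [a, 0, 2 * z + a], [1, 0, 2]]

theorem exec_mainProg (hin : HoldsInput m n num den) (hn : 2 ≤ n) {b : ℕ} (hb : 1 ≤ b)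
    (hnb : n + 2 ≤ b) (hm : ∀ x, bits (m x) ≤ b)
    (hS : ∀ i < n, bits (partialExcess num den i).1 ≤ b)
    (hQ : ∀ i < n, bits (partialExcess num den i).2 ≤ b) (u z a : ℤ)
    (hu : u = num 1 * den 0 * (partialExcess num den (n - 1)).2)
    (hz : z = num 0 * den 1 * (partialExcess num den (n - 1)).2)
    (ha : a = den 0 * den 1 * (partialExcess num den (n - 1)).1) :
    ∃ v', Exec (60 * b) m mainProg (List.replicate 10 0) v'
      (allOut ((solution u z a).getD 0 []) ((solution u z a).getD 1 [])
        ((solution u z a).getD 2 []) ((solution u z a).getD 3 []) n)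
      (progCost * (n + 1) ^ 2) := by
  set S := (partialExcess num den (n - 1)).1 with hSdef
  set Q := (partialExcess num den (n - 1)).2 with hQdef
  have m2 : m 2 = den 0 := by simpa using hin.den 0 (by omega)
  have m1 : m 1 = num 0 := by simpa using hin.num 0 (by omega)
  have m3 : m 3 = num 1 := by simpa using hin.num 1 (by omega)
  have m4 : m 4 = den 1 := by simpa using hin.den 1 (by omega)
  have hbd : ∀ k ≤ n, bits (den k) ≤ b := fun k hk => by rw [← hin.den k hk]; exact hm _
  have hbn : ∀ k ≤ n, bits (num k) ≤ b := fun k hk => by rw [← hin.num k hk]; exact hm _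
  have h3 : ∀ {x y t : ℤ}, bits x ≤ b → bits y ≤ b → bits t ≤ b → bits (x * y * t) ≤ 3 * b := by
    intro x y t hx hy ht
    have h1 := bits_mul_le (x * y) t
    have h2 := bits_mul_le x y
    omega
  have hub : bits u ≤ 3 * b := by
    rw [hu]; exact h3 (hbn 1 (by omega)) (hbd 0 (by omega)) (hQ _ (by omega))
  have hzb : bits z ≤ 3 * b := by
    rw [hz]; exact h3 (hbn 0 (by omega)) (hbd 1 (by omega)) (hQ _ (by omega))
  have hab : bits a ≤ 3 * b := by
    rw [ha]; exact h3 (hbd 0 (by omega)) (hbd 1 (by omega)) (hS _ (by omega))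
  set f := (a + 2 * z) * (a + 2 * z) - 8 * (z * z) with hf
  -- `z` and `a` are products of three factors of at most `b` bits. The test expression has weight
  -- `17`, so `17 * 3 b ≤ 60 b` bits suffice.
  have hfb : bits f ≤ 60 * b := by
    have h0 : bits 0 = 1 := rfl
    have hbd : Arith.Bounded (3 * b) (fun _ => 0) [0, 0, 0, 0, 0, 0, 0, z, a] :=
      ⟨by omega, fun _ => by rw [h0]; omega, fun x hx => by
        simp only [List.mem_cons, List.not_mem_nil, or_false] at hx
        rcases hx with rfl | rfl | rfl | rfl | rfl | rfl | rfl | rfl | rfl <;>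
          first | assumption | (rw [h0]; omega)⟩
    have h1 := Arith.bits_eval_le hbd testExpr
    have h2 : testExpr.weight = 17 := by decide
    rw [h2] at h1
    exact h1.trans (by omega)
  have e0 := exec_accumulate (B := 60 * b) hin hn (by omega) (fun i hi => (hS i hi).trans (by omega))
    (fun i hi => (hQ i hi).trans (by omega))
  set K : ℤ := 2 + (n - 1 : ℕ) with hK
  set c : ℤ := n - 1 - (n - 1 : ℕ) with hc
  have e6 : Exec (60 * b) m (assign 6 (.mul (.mul (.mem (.const 3)) (.mem (.const 2))) (.reg 2)))
      (accRegs n num den (n - 1)) (finalRegs n S Q K c u 0 0 0) [] 40 := by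
    refine exec_assign_of_eq (x := u) (by norm_num) (by decide) ?_ (by omega) rfl (by decide)
    rw [hu, ← m3, ← m2]; rfl
  have e7 : Exec (60 * b) m (assign 7 (.mul (.mul (.mem (.const 1)) (.mem (.const 4))) (.reg 2)))
      (finalRegs n S Q K c u 0 0 0) (finalRegs n S Q K c u z 0 0) [] 40 := by
    refine exec_assign_of_eq (x := z) (by norm_num) (by decide) ?_ (by omega) rfl (by decide)
    rw [hz, ← m1, ← m4]; rfl
  have e8 : Exec (60 * b) m (assign 8 (.mul (.mul (.mem (.const 2)) (.mem (.const 4))) (.reg 1)))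
      (finalRegs n S Q K c u z 0 0) (finalRegs n S Q K c u z a 0) [] 40 := by
    refine exec_assign_of_eq (x := a) (by norm_num) (by decide) ?_ (by omega) rfl (by decide)
    rw [ha, ← m2, ← m4]; rfl
  have e9 : Exec (60 * b) m (assign 9 testExpr)
      (finalRegs n S Q K c u z a 0) (finalRegs n S Q K c u z a f) [] 120 :=
    exec_assign_of_eq (x := f) (by norm_num) (by decide) rfl hfb rfl (by decide)
  have hfin : ∀ {C : ℕ} {v' w : List ℤ}, Exec (60 * b) m (.ite 9 emitInterior emitCorner)
        (finalRegs n S Q K c u z a f) v' w (1 + C * (n + 1) ^ 2) → C ≤ progCost - 500 →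
      Exec (60 * b) m mainProg (List.replicate 10 0) v' w (progCost * (n + 1) ^ 2) := by
    intro C v' w h hC
    refine (e0.seq (e6.seq (e7.seq (e8.seq (e9.seq h))))).mono ?_
    have h500 : 500 ≤ progCost := by unfold progCost; omega
    have : (500 + C) * (n + 1) ^ 2 ≤ progCost * (n + 1) ^ 2 :=
      Nat.mul_le_mul_right _ (by omega)
    nlinarith
  rcases lt_or_ge 0 f with hpos | hneg
  · obtain ⟨v', h⟩ := exec_emitAll (B := 60 * b) (m := m) (v := finalRegs n S Q K c u z a f)
      (w := ⟨poolRat, .sub (.const 0) poolIrr, poolDen⟩)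
      (w' := ⟨.sub poolDen poolRat, poolIrr, poolDen⟩)
      (t₀ := ⟨.add (.mul (.const 2) (.reg 6)) (.reg 8), .sub (.const 0) (.reg 6), bidDen⟩)
      (t₁ := ⟨.add (.reg 6) shiftExpr, .sub (.const 0) (.reg 7), bidDen⟩)
      ⟨by decide, by decide, by decide, by decide⟩ ⟨by decide, by decide, by decide, by decide⟩
      ⟨by decide, by decide, by decide, by decide⟩ ⟨by decide, by decide, by decide, by decide⟩
      hn (by omega) rfl rfl rfl
    rw [solution, if_pos hpos]
    exact ⟨v', hfin (Exec.ite (by norm_num) (fun _ => h) fun h' => absurd hpos h'.not_gt)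
      (by unfold progCost; omega)⟩
  · obtain ⟨v', h⟩ := exec_emitAll (B := 60 * b) (m := m) (v := finalRegs n S Q K c u z a f)
      (w := .int 0) (w' := .int 1)
      (t₀ := ⟨.reg 8, .const 0, .add (.mul (.const 2) (.reg 7)) (.reg 8)⟩)
      (t₁ := ⟨.const 1, .const 0, .const 2⟩)
      ⟨by decide, by decide, by decide, by decide⟩ ⟨by decide, by decide, by decide, by decide⟩
      ⟨by decide, by decide, by decide, by decide⟩ ⟨by decide, by decide, by decide, by decide⟩
      hn (by omega) rfl rfl rfl
    rw [solution, if_neg hneg.not_gt]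
    exact ⟨v', hfin (Exec.ite (by norm_num) (fun h' => absurd h' hneg.not_gt) fun _ => h)
      (by unfold progCost; omega)⟩

end Program

/-! ### Correctness of the program -/

section Correctness

variable {n : ℕ}

/-- The printed numbers describe the optimal signaling. -/
theorem exists_description (hn : 2 ≤ n) {lam : Prior n} (h0 : 0 < lam.level 0)
    (h1 : 0 < lam.level 1) (hA : 0 < excess n lam.level) {u z a : ℤ} {M : ℝ} (hM : 0 < M)
    (hzL : (z : ℝ) = M * lam.level 0) (huL : (u : ℝ) = M * lam.level 1)
    (haL : (a : ℝ) = M * excess n lam.level) :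
    ∃ D : Description n,
      D.encode = allOut ((solution u z a).getD 0 []) ((solution u z a).getD 1 [])
        ((solution u z a).getD 2 []) ((solution u z a).getD 3 []) n ∧
      D.Describes (optimalSignaling lam h0 h1 hA) := by
  have hz : 0 < z := by
    have : (0 : ℝ) < z := by rw [hzL]; positivity
    exact_mod_cast this
  have hu : 0 < u := by
    have : (0 : ℝ) < u := by rw [huL]; positivity
    exact_mod_cast this
  have ha : 0 < a := by
    have : (0 : ℝ) < a := by rw [haL]; positivity
    exact_mod_cast this
  have hθ := poolProb_mem h0 h1 hA
  have key : ∀ w w' t₀ t₁ : Num, w.val = poolProb n lam.level → w'.val = 1 - w.val →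
      t₀.val = tZero n lam.level → t₁.val = tOne n lam.level →
      (lotteryDescription n w w' t₀ t₁).Describes (optimalSignaling lam h0 h1 hA) := by
    intro w w' t₀ t₁ e e' e0 e1
    refine describes_lotteryDescription (h := target n lam.level) (by rw [e]; exact hθ.1) e'
      (by rw [e]; exact hθ.2) (fun k => by rw [e0, e1]; rfl) ?_
    rw [e, e0, e1]
    rfl
  rcases lt_or_ge 0 ((a + 2 * z) * (a + 2 * z) - 8 * (z * z)) with h | h
  · obtain ⟨f1, f0, fθ⟩ := interior_formulas hu hz ha hM hzL huL haL h
    have hw : u * u - 2 * (z * z) ≠ 0 := sq_sub_two_mul_sq_ne_zero hz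
    have hd : 0 < (u * u - 2 * (z * z)) * (u * u - 2 * (z * z)) * a :=
      mul_pos (mul_self_pos.2 hw) ha
    have hd' : 0 < 2 * u + (a + 2 * z) := by omega
    have hdR : (((u * u - 2 * (z * z)) * (u * u - 2 * (z * z)) * a : ℤ) : ℝ) ≠ 0 := by
      exact_mod_cast hd.ne'
    rw [solution, if_pos h]
    set p := u * (u * u - 2 * (z * z)) * (u * (a + 2 * z) + 4 * (z * z)) with hp
    set q := u * (u * u - 2 * (z * z)) * (z * (a + 2 * z + 2 * u)) with hq
    set d := (u * u - 2 * (z * z)) * (u * u - 2 * (z * z)) * a with hdd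
    refine ⟨lotteryDescription n (.ofInt p (0 - q) d hd) (.ofInt (d - p) q d hd)
      (.ofInt (2 * u + a) (0 - u) _ hd') (.ofInt (u + (a + 2 * z)) (0 - z) _ hd'), ?_,
      key _ _ _ _ ?_ ?_ ?_ ?_⟩
    · rw [encode_lotteryDescription hn]
      simp only [Num.encode_ofInt]
      rfl
    · rw [Num.val_ofInt, fθ, hp, hq, hdd]; push_cast; rw [zero_sub]
    · rw [Num.val_ofInt, Num.val_ofInt, eq_sub_iff_add_eq, ← add_div, div_eq_one_iff_eq hdR]
      push_cast; ring
    · rw [Num.val_ofInt, f0]; push_cast; rw [zero_sub]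
    · rw [Num.val_ofInt, f1]; push_cast; rw [zero_sub]
  · obtain ⟨f1, f0, fθ⟩ := corner_formulas hu hz ha hM hzL huL haL h
    have hd : 0 < 2 * z + a := by omega
    rw [solution, if_neg h.not_gt]
    refine ⟨lotteryDescription n (.ofInt 0 0 1 one_pos) (.ofInt 1 0 1 one_pos) (.ofInt a 0 _ hd)
      (.ofInt 1 0 2 two_pos), ?_, key _ _ _ _ ?_ ?_ ?_ ?_⟩
    · rw [encode_lotteryDescription hn]
      simp only [Num.encode_ofInt]
      rfl
    · rw [Num.val_ofInt, fθ]; simp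
    · rw [Num.val_ofInt, Num.val_ofInt]; simp
    · rw [Num.val_ofInt, f0]; push_cast; simp
    · rw [Num.val_ofInt, f1]; push_cast; simp

theorem holds_initState {b : ℕ} {l : List ℤ} (hb : 1 ≤ b) (hm : ∀ x, bits ((initState l).mem x) ≤ b) :
    Holds b (initState l).mem (List.replicate 10 0) (initState l) where
  bounded := ⟨hb, hm, fun x hx => by rw [List.eq_of_mem_replicate hx]; exact hb⟩
  length := List.length_replicate
  reg r hr := by interval_cases r <;> rfl
  mem := rfl

theorem excess_eq_partialExcess (hn : 2 ≤ n) {L : ℕ → ℝ} {num den : ℕ → ℕ} (hden : ∀ k, 0 < den k)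
    (hL : ∀ k ≤ n, L k = num k / den k) :
    ((partialExcess num den (n - 1)).1 : ℝ) = (partialExcess num den (n - 1)).2 * excess n L := by
  rw [partialExcess_eq hden, excess]
  congr 1
  rw [← Ico_add_one_right_eq_Icc, sum_Ico_eq_sum_range, show n + 1 - 2 = n - 1 by omega]
  refine sum_congr rfl fun j hj => ?_
  have := mem_range.1 hj
  rw [hL (2 + j) (by omega)]
  push_cast
  ring

theorem mainProg_correct (hn : 2 ≤ n) {lam : Prior n} (h0 : 0 < lam.level 0)
    (h1 : 0 < lam.level 1) (hA : 0 < excess n lam.level) (num den : ℕ → ℕ)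
    (hden : ∀ k, 0 < den k) (hL : ∀ k ≤ n, lam.level k = num k / den k) :
    ∃ (D : Description n) (s : State) (T : ℕ),
      Runs mainProg (initState (inputList n (fun k => num k) (fun k => den k))) s T ∧
      T ≤ progCost * 180 ^ 2 * (inputSize n (fun k => num k) (fun k => den k) + 1) ^ 4 ∧
      s.out = D.encode ∧ D.Describes (optimalSignaling lam h0 h1 hA) := by
  set N := inputSize n (fun k => num k) (fun k => den k) with hN
  set S := (partialExcess num den (n - 1)).1 with hSdef
  set Q := (partialExcess num den (n - 1)).2 with hQdef
  have hQpos : (0 : ℝ) < Q := by exact_mod_cast partialExcess_snd_pos hden _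
  have hd : ∀ k, (0 : ℝ) < den k := fun k => by exact_mod_cast hden k
  have hnN : n ≤ N := Nat.le_add_right _ _
  have hsize : ∀ i < n, (partialExcess num den i).1.size ≤ 2 * N + 1 ∧
      (partialExcess num den i).2.size ≤ 2 * N + 1 := fun i hi => by
    have h := size_partialExcess (num := num) (den := den) i hi.le
    have h' := sum_size_le_inputSize (n := n) num den (i := i) hi
    constructor <;> omega
  -- The scale `M = den 0 * den 1 * Q` is a common denominator of `λ₀`, `λ₁` and `A`.
  obtain ⟨D, hD, hDπ⟩ := exists_description hn h0 h1 hA (M := den 0 * den 1 * Q)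
    (u := num 1 * den 0 * Q) (z := num 0 * den 1 * Q) (a := den 0 * den 1 * S)
    (mul_pos (mul_pos (hd 0) (hd 1)) hQpos)
    (by rw [hL 0 (by omega)]; push_cast; have := (hd 0).ne'; field_simp)
    (by rw [hL 1 (by omega)]; push_cast; have := (hd 1).ne'; field_simp)
    (by
      push_cast
      rw [hSdef, excess_eq_partialExcess hn hden hL]
      ring)
  -- The partial sums have size at most `2 N + 1`, hence at most `2 N + 2` bits with the sign, and
  -- `n + 2 ≤ N + 2`; `3 (N + 1)` dominates both.
  obtain ⟨v', hexec⟩ := exec_mainProg (holdsInput_initState (n := n) num den) hn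
    (b := 3 * (N + 1)) (by omega) (by omega)
    (fun x => (bits_initState_le num den x).trans (by omega))
    (fun i hi => (Nat.add_le_add_right (hsize i hi).1 1).trans (by omega))
    (fun i hi => (Nat.add_le_add_right (hsize i hi).2 1).trans (by omega)) _ _ _ rfl rfl rfl
  obtain ⟨s, T, hr, hT, -, ho⟩ := hexec _ (holds_initState (by omega)
    fun x => (bits_initState_le num den x).trans (by omega))
  refine ⟨D, s, T, hr, hT.trans ?_, ?_, hDπ⟩
  · calc progCost * (n + 1) ^ 2 * (60 * (3 * (N + 1))) ^ 2
        ≤ progCost * (N + 1) ^ 2 * (60 * (3 * (N + 1))) ^ 2 := by gcongr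
      _ = progCost * 180 ^ 2 * (N + 1) ^ 4 := by ring
  · rw [ho, hD]
    rfl

end Correctness

end CalibratedSignaling

open CalibratedSignaling in
theorem theorem1 :
    -- one program and one polynomial time bound, for all numbers of bidders and all priors
    ∃ (P : Prog) (p : Polynomial ℕ),
      ∀ (n : ℕ) (lam : Prior n),
        0 < lam.level 0 → 0 < lam.level 1 → (∃ k, 3 ≤ k ∧ 0 < lam.level k) →
        -- the thresholds, and their expression through the linear system
        tOne n lam.level ∈ Set.Ico (1 / 2 : ℝ) 1 ∧
        tZero n lam.level ∈ Set.Ioc (0 : ℝ) (tOne n lam.level) ∧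
        (∃ m l : ℕ → ℝ, LinSys n lam.level m l) ∧
        (∀ m l : ℕ → ℝ, LinSys n lam.level m l →
          tOne n lam.level =
            (lam.level 1 + ∑ k ∈ Finset.Icc 2 n, lam.level k * (k * m k)) /
              (2 * lam.level 1 + ∑ k ∈ Finset.Icc 2 n, lam.level k * (k * m k)) ∧
          tZero n lam.level =
            (∑ k ∈ Finset.Icc 2 n, lam.level k * (k * l k)) /
              (2 * lam.level 0 + ∑ k ∈ Finset.Icc 2 n, lam.level k * (k * l k))) ∧
        -- the optimal calibrated signaling
        ∃ π : Signaling n,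
          IsOptimal lam π ∧
          (∀ o, ∀ x ∈ (π.law o).support, MultiMaximal x) ∧
          (∀ o, (π.law o).map secmax =
            MeasureTheory.Measure.dirac (target n lam.level (clicks o))) ∧
          -- it is computed in polynomial time when the `λ_k` are given as fractions
          ∀ num den : Fin (n + 1) → ℕ,
            (∀ k, 0 < den k) →
            (∀ k : Fin (n + 1), lam.level k = (num k : ℝ) / (den k : ℝ)) →
            ∃ (D : Description n) (s : State) (T : ℕ),
              Runs P (initState (inputList n num den)) s T ∧
              T ≤ p.eval (inputSize n num den) ∧
              s.out = D.encode ∧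
              D.Describes π := by
  refine ⟨mainProg, Polynomial.C (progCost * 180 ^ 2) * (Polynomial.X + 1) ^ 4, ?_⟩
  rintro n lam h0 h1 ⟨k, hk, hkpos⟩
  have hn : 3 ≤ n := hk.trans (le_of_level_pos hkpos)
  have hA : 0 < excess n lam.level := excess_level_pos hk hkpos
  refine ⟨tOne_mem_Ico h1, ⟨tZero_pos h0 h1 hA, tZero_le_tOne h0 h1 hA⟩,
    exists_linSys h0 h1 hA hn, fun m l h => h.thresholds, optimalSignaling lam h0 h1 hA,
    isOptimal_optimalSignaling h0 h1 hA hn, support_optimalSignaling h0 h1 hA hn,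
    map_secmax_optimalSignaling h0 h1 hA hn, fun num den hden hL => ?_⟩
  obtain ⟨num', hnum⟩ : ∃ num' : ℕ → ℕ, num = fun k : Fin (n + 1) => num' k :=
    ⟨fun k => if h : k < n + 1 then num ⟨k, h⟩ else 0, funext fun k => by dsimp only; rw [dif_pos k.isLt]⟩
  -- The sequences are extended beyond `n`; the default `1` keeps all denominators positive.
  obtain ⟨den', hden', hd⟩ : ∃ den' : ℕ → ℕ, den = (fun k : Fin (n + 1) => den' k) ∧
      ∀ k, 0 < den' k := by
    refine ⟨fun k => if h : k < n + 1 then den ⟨k, h⟩ else 1, funext fun k => by dsimp only; rw [dif_pos k.isLt],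
      fun k => ?_⟩
    dsimp only
    split_ifs
    · exact hden _
    · exact one_pos
  subst hnum hden'
  obtain ⟨D, s, T, hr, hT, ho, hD⟩ := mainProg_correct (by omega) h0 h1 hA num' den' hd
    fun k hk => hL ⟨k, Nat.lt_succ_of_le hk⟩
  exact ⟨D, s, T, hr, by simpa using hT, ho, hD⟩
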